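/- Let $d\ge 0$ and let $\psi:\mathbb R^d\to\mathbb R$ be a smooth continuous negative definite function, i.e. $\psi(\xi)=c+ib\cdot\xi+\tfrac12\,\xi\cdot Q\xi+\int_{\mathbb R^d\setminus\{0\}}\bigl(1-e^{i\xi\cdot y}+\tfrac{i\xi\cdot y}{1+|y|^2}\bigr)\nu(dy)$ with $c\ge0$, $b\in\mathbb R^d$, $Q$ positive semi-definite and $\int_{\mathbb R^d\setminus\{0\}}\min(|y|^2,1)\,\nu(dy)<\infty$. Put $\langle\xi\rangle=(1+\psi(\xi))^{1/2}$ and $\rho_g(n)=\min(n,g)$, and assume that for every $\alpha\in\mathbb N_0^d$ there is $K_\alpha$ with $|\partial_\xi^\alpha\langle\xi\rangle^2|\le K_\alpha\langle\xi\rangle^{2-\rho_2(|\alpha|)}$ for all $\xi$. For $k\ge1$, $g\in\{0,1,2\}$ and $\tilde m_k=(m_1,\dots,m_k)\in\mathbb R^k$, let $S^{\tilde m_k,\psi}_{\rho_g}(\mathbb R^{2kd})$ be the class of multiple symbols: all $C^\infty$ functions $a(x^1,\xi^1,\dots,x^k,\xi^k)$ with values in $\mathbb C$ such that for all $\tilde\alpha=(\alpha^1,\dots,\alpha^k)$,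 $\tilde\beta=(\beta^1,\dots,\beta^k)\in\mathbb N_0^{kd}$ there is a constant $K$ with $|\partial_{\tilde\xi}^{\tilde\alpha}D_{\tilde x}^{\tilde\beta}a|\le K\prod_{j=1}^k\langle\xi^j\rangle^{m_j-\rho_g(|\alpha^j|)}$ everywhere, where $D=-i\partial$. For $l,l'\in\mathbb N_0$ put $$|a|^{(\tilde m_k)}_{l,l'}=\max_{|\alpha^j|\le l,\ |\beta^j|\le l'\ (1\le j\le k)}\ \sup_{\tilde x,\tilde\xi}\Bigl(|\partial_{\tilde\xi}^{\tilde\alpha}D_{\tilde x}^{\tilde\beta}a|\prod_{j=1}^k\langle\xi^j\rangle^{-m_j+\rho_g(|\alpha^j|)}\Bigr).$$ The oscillatory integral $\mathrm{Os}\text{-}\!\int e^{-i\tilde y\cdot\tilde\eta}f(\tilde y,\tilde\eta)$ over $\mathbb R^{2(k-1)d}$ is the limit, as $\varepsilon\to0^+$, of $(2\pi)^{-(k-1)d}\int e^{-i\tilde y\cdot\tilde\eta}\chi(\varepsilon\tilde y,\varepsilon\tilde\eta)f(\tilde y,\tilde\eta)\,d\tilde y\,d\tilde\eta$; it is said to exist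 if, for every Schwartz function $\chi$ on $\mathbb R^{2(k-1)d}$ with $\chi(0)=1$, these integrals converge absolutely for all $\varepsilon>0$ and the limit exists and does not depend on $\chi$. **Theorem.** For every $M\geq 0$ there is a constant $C=C(M)>0$, depending only on $M$, $d$ and $\psi$ (in particular not on $k$), such that the following holds for all $k\ge1$, $g\in\{0,1,2\}$, $\tilde m_k\in\mathbb R^k$ with $\sum_{j=1}^{k-1}|m_j|=M$, $a\in S^{\tilde m_k,\psi}_{\rho_g}(\mathbb R^{2kd})$ and $\theta\in\mathbb R$ with $|\theta|\le1$. For all $x,\xi\in\mathbb R^d$ the oscillatory integral $$b_\theta(x,\xi)=\mathrm{Os}\text{-}\!\int e^{-i\sum_{j=1}^{k-1}y^j\cdot\eta^j}\,a\bigl(x,\ \xi+\theta\eta^1,\ x+y^1,\ \xi+\theta\eta^2,\ x+y^1+y^2,\ \dots,\ \xi+\theta\eta^{k-1},\ x+y^1+\dots+y^{k-1},\ \xi\bigr)$$ over $(\tilde y,\tilde\eta)\in\mathbb R^{2(k-1)d}$ exists, and $$|b_\theta(x,\xi)|\le C^{k+1}\,|a|^{(\tilde m_k)}_{l,l'}\,\langle\xi\rangle^{m_1+\dots+m_k},\qquad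 l=2\Bigl\lceil\tfrac d2+1\Bigr\rceil,\quad l'=2\Bigl\lceil\tfrac{d+\sum_{j=1}^{k-1}|m_j|}2+1\Bigr\rceil .$$ -/

import Mathlib

open scoped SchwartzMap ContDiff

noncomputable section

namespace NegDefSymbol

/-- Directional derivative of `f` along the fixed vector `v`. -/
def dirDeriv {V F : Type*} [NormedAddCommGroup V] [NormedSpace ℝ V]
    [NormedAddCommGroup F] [NormedSpace ℝ F] (v : V) (f : V → F) : V → F :=
  fun z => fderiv ℝ f z v

/-- `∂_{e 0}^{α 0} ∂_{e 1}^{α 1} ⋯ ∂_{e (d-1)}^{α (d-1)} f`. -/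
def multiDeriv {V F : Type*} [NormedAddCommGroup V] [NormedSpace ℝ V]
    [NormedAddCommGroup F] [NormedSpace ℝ F] {d : ℕ} (e : Fin d → V) (α : Fin d → ℕ)
    (f : V → F) : V → F :=
  (List.finRange d).foldr (fun i h => (dirDeriv (e i))^[α i] h) f

/-- The Euclidean space `ℝ^d`. -/
abbrev E (d : ℕ) : Type := EuclideanSpace ℝ (Fin d)

/-- `k`-tuples of points of `ℝ^d`. -/
abbrev Tup (k d : ℕ) : Type := Fin k → E d

/-- The order `|α|` of a multi-index. -/
def order {d : ℕ} (α : Fin d → ℕ) : ℕ := ∑ i, α i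

/-- The cut-off function `ρ_g(n) = min(n, g)`. -/
def rho (g n : ℕ) : ℕ := min n g

/-- Continuous negative definite functions on `ℝ^d`, through the Lévy–Khintchine formula. -/
def IsContNegDef {d : ℕ} (ψ : E d → ℂ) : Prop :=
  ∃ (c : ℝ) (b : E d) (Q : Matrix (Fin d) (Fin d) ℝ) (ν : MeasureTheory.Measure (E d)),
    0 ≤ c ∧ Q.PosSemidef ∧
    (∫⁻ y in {0}ᶜ, ENNReal.ofReal (min (‖y‖ ^ 2) 1) ∂ν) < ⊤ ∧
    ∀ ξ : E d, ψ ξ = (c : ℂ) + Complex.I * ((inner ℝ b ξ : ℝ) : ℂ)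
      + ((1 / 2 * (ξ.ofLp ⬝ᵥ (Q.mulVec ξ.ofLp)) : ℝ) : ℂ)
      + ∫ y in {0}ᶜ, (1 - Complex.exp (Complex.I * ((inner ℝ ξ y : ℝ) : ℂ))
          + Complex.I * ((inner ℝ ξ y / (1 + ‖y‖ ^ 2) : ℝ) : ℂ)) ∂ν

/-- The bracket `⟨ξ⟩ = (1 + ψ(ξ))^{1/2}`. -/
def bracket {d : ℕ} (ψ : E d → ℝ) (ξ : E d) : ℝ := Real.sqrt (1 + ψ ξ)

/-- Real-valued, smooth continuous negative definite functions `ψ` with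
`|∂^α ⟨ξ⟩²| ≲_α ⟨ξ⟩^{2 - ρ_2(|α|)}` for every multi-index `α`. -/
structure IsAdmissible {d : ℕ} (ψ : E d → ℝ) : Prop where
  negDef : IsContNegDef (fun ξ => (ψ ξ : ℂ))
  smooth : ContDiff ℝ ∞ ψ
  bound : ∀ α : Fin d → ℕ, ∃ K : ℝ, ∀ ξ : E d,
    |multiDeriv (fun i => EuclideanSpace.single i (1 : ℝ)) α (fun η => bracket ψ η ^ 2) ξ|
      ≤ K * bracket ψ ξ ^ ((2 : ℝ) - (rho 2 (order α) : ℝ))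

/-- The derivative `∂_{ξ̃}^{α̃} D_{x̃}^{β̃} a`, with `D = -i ∂`, of a function of
`(x̃, ξ̃) ∈ ℝ^{kd} × ℝ^{kd}`. The multi-indices `α̃ = (α^1, …, α^k)` and `β̃ = (β^1, …, β^k)`
consist of `k` blocks of length `d`. -/
def symbolDeriv {k d : ℕ} (α β : Fin k → Fin d → ℕ) (a : Tup k d × Tup k d → ℂ) :
    Tup k d × Tup k d → ℂ :=
  (List.finRange k).foldr
    (fun j h => multiDeriv
      (fun i => ((0, Pi.single j (EuclideanSpace.single i (1 : ℝ))) : Tup k d × Tup k d)) (α j) h)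
    (fun z => (-Complex.I) ^ (∑ j, order (β j)) *
      (List.finRange k).foldr
        (fun j h => multiDeriv
          (fun i => ((Pi.single j (EuclideanSpace.single i (1 : ℝ)), 0) : Tup k d × Tup k d))
          (β j) h)
        a z)

/-- The class of multiple symbols `S^{m̃_k, ψ}_{ρ_g}(ℝ^{2kd})`; the argument of `a` is
`(x̃, ξ̃) = ((x^1, …, x^k), (ξ^1, …, ξ^k))`. -/
structure IsMultipleSymbol {k d : ℕ} (ψ : E d → ℝ) (g : ℕ) (m : Fin k → ℝ)
    (a : Tup k d × Tup k d → ℂ) : Prop where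
  smooth : ContDiff ℝ ∞ a
  bound : ∀ α β : Fin k → Fin d → ℕ, ∃ K : ℝ, ∀ x ξ : Tup k d,
    ‖symbolDeriv α β a (x, ξ)‖
      ≤ K * ∏ j, bracket ψ (ξ j) ^ (m j - (rho g (order (α j)) : ℝ))

/-- The semi-norm `|a|_{l,l'}^{(m̃_k)}`: the supremum runs over all points `(x̃, ξ̃)` and all
multi-indices with `|α^j| ≤ l` and `|β^j| ≤ l'` for each block `j`. -/
def symbolSeminorm {k d : ℕ} (ψ : E d → ℝ) (g : ℕ) (m : Fin k → ℝ) (l l' : ℕ)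
    (a : Tup k d × Tup k d → ℂ) : ℝ :=
  sSup {r : ℝ | ∃ (α β : Fin k → Fin d → ℕ) (x ξ : Tup k d),
    (∀ j, order (α j) ≤ l) ∧ (∀ j, order (β j) ≤ l') ∧
    r = ‖symbolDeriv α β a (x, ξ)‖
      * ∏ j, bracket ψ (ξ j) ^ (-m j + (rho g (order (α j)) : ℝ))}

/-- `I` is the oscillatory integral `Os-∫ e^{-i ỹ·η̃} f(ỹ, η̃) đỹ đη̃` over `ℝ^{2nd}`, where
`đỹ đη̃ = (2π)^{-nd} dỹ dη̃`: for every Schwartz function `χ` with `χ(0) = 1` the regularised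
integrals converge absolutely, and they tend to `I` as `ε → 0+`. -/
def IsOscIntegral {n d : ℕ} (f : Tup n d × Tup n d → ℂ) (I : ℂ) : Prop :=
  ∀ χ : 𝓢(Tup n d × Tup n d, ℂ), χ 0 = 1 →
    (∀ ε : ℝ, 0 < ε → MeasureTheory.Integrable (fun p : Tup n d × Tup n d =>
      Complex.exp (-(Complex.I * ((∑ j, inner ℝ (p.1 j) (p.2 j) : ℝ) : ℂ)))
        * χ (ε • p) * f p)) ∧
    Filter.Tendsto (fun ε : ℝ => (((2 * Real.pi) ^ (n * d) : ℝ) : ℂ)⁻¹ *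
      ∫ p : Tup n d × Tup n d,
        Complex.exp (-(Complex.I * ((∑ j, inner ℝ (p.1 j) (p.2 j) : ℝ) : ℂ)))
          * χ (ε • p) * f p)
      (nhdsWithin 0 (Set.Ioi 0)) (nhds I)

/-- An oscillatory integral has at most one value. -/
theorem IsOscIntegral.unique {n d : ℕ} {f : Tup n d × Tup n d → ℂ} {I J : ℂ}
    (hI : IsOscIntegral f I) (hJ : IsOscIntegral f J) : I = J := by
  obtain ⟨χ, hχ⟩ : ∃ χ : 𝓢(Tup n d × Tup n d, ℂ), χ 0 = 1 := by
    obtain ⟨u, -, hu, hs, -, h1⟩ :=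
      exists_contDiff_tsupport_subset (E := Tup n d × Tup n d) (n := ⊤) (s := Set.univ) (x := 0)
        Filter.univ_mem
    have hc : HasCompactSupport (fun z => (u z : ℂ)) := hu.comp_left (g := Complex.ofReal) rfl
    refine ⟨hc.toSchwartzMap (Complex.ofRealCLM.contDiff.comp hs), ?_⟩
    change ((u 0 : ℝ) : ℂ) = 1
    rw [h1]; simp
  exact tendsto_nhds_unique (hI χ hχ).2 (hJ χ hχ).2

/-- The amplitude `(ỹ, η̃) ↦ a(x, ξ + θη^1, x + y^1, ξ + θη^2, …, x + y^1 + ⋯ + y^n, ξ)`,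
for a symbol `a` with `n + 1` blocks. -/
def shiftedAmplitude {n d : ℕ} (a : Tup (n + 1) d × Tup (n + 1) d → ℂ) (θ : ℝ) (x ξ : E d) :
    Tup n d × Tup n d → ℂ :=
  fun p => a
    (fun j => x + ∑ i : Fin n with i.castSucc < j, p.1 i,
     Fin.snoc (α := fun _ => E d) (fun j => ξ + θ • p.2 j) ξ)

end NegDefSymbol

end

open NegDefSymbol

noncomputable section

namespace NegDefSymbol

/-! ### Iterated directional derivatives and Leibniz bounds. -/

section ListDeriv

variable {V W F : Type*} [NormedAddCommGroup V] [NormedSpace ℝ V]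
  [NormedAddCommGroup W] [NormedSpace ℝ W] [NormedAddCommGroup F] [NormedSpace ℝ F]

/-! Write n = k - 1. In terms of the partial sums z^j = y^1 + ⋯ + y^j, the phase is ∑ z^j · (η^j -
η^{j+1}) with η^{n+1} = 0, and z^j enters the amplitude only through the block x^{j+1} = x + z^j.
Integrating by parts N times with 1 - Δ in every z^j produces the weights (1 + |η^j -
η^{j+1}|²)^{-N}, at the cost of at most 2N derivatives of `a` in each position block. Integrating by
parts N' times in every η^j then produces (1 + |y^j|²)^{-N'}, at the cost of at most 2N' derivatives
in each frequency block. No change of variables is made: differentiating along `posDir` plays the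
role of ∂/∂z^j (`integral_oscFactor_mul`).

The constants must grow only geometrically in k. Each η^r enters just two of the differences η^j -
η^{j+1}, so a frequency derivative hits at most two weight factors, and the Leibniz rule costs a
factor 2 per derivative instead of n (`norm_listDeriv_prod_le`, `norm_oscTransform_le`).

The symbol estimate leaves ∏ ⟨ξ + θη^j⟩^{m_j}. The first order bound on ⟨ξ⟩² makes ⟨ξ⟩ Lipschitz,
which gives Peetre's inequality. Since η^j is a sum of differences η^i - η^{i+1} and 1 + ∑ t_i ≤ ∏
(1 + t_i), the product is at most ⟨ξ⟩^{m_1 + ⋯ + m_k} ∏ (1 + L|η^i - η^{i+1}|)^M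
(`prod_bracket_rpow_le`). The remaining integral factorises under a unipotent substitution into n-th
powers of two integrals over ℝ^d, which are finite when 2N > d + M and 2N' > d
(`integrable_prod_weights`).

Existence of the oscillatory integral uses the same majorant: the integrations by parts are
legitimate with the cut-off χ(ε·), and dominated convergence removes it afterwards
(`isOscIntegral_oscIntegral`). -/

theorem contDiff_dirDeriv {f : V → F} (hf : ContDiff ℝ ∞ f) (v : V) :
    ContDiff ℝ ∞ (dirDeriv v f) :=
  (hf.fderiv_right (m := ∞) le_rfl).clm_apply contDiff_const

theorem smooth_differentiable {f : V → F} (hf : ContDiff ℝ ∞ f) : Differentiable ℝ f :=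
  hf.differentiable (by simp)

theorem dirDeriv_add {f g : V → F} (hf : ContDiff ℝ ∞ f) (hg : ContDiff ℝ ∞ g) (v : V) :
    dirDeriv v (fun z => f z + g z) = fun z => dirDeriv v f z + dirDeriv v g z := by
  funext z
  simp only [dirDeriv]
  rw [fderiv_fun_add (smooth_differentiable hf z) (smooth_differentiable hg z)]
  rfl

theorem dirDeriv_sub {f g : V → F} (hf : ContDiff ℝ ∞ f) (hg : ContDiff ℝ ∞ g) (v : V) :
    dirDeriv v (fun z => f z - g z) = fun z => dirDeriv v f z - dirDeriv v g z := by
  funext z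
  simp only [dirDeriv]
  rw [fderiv_fun_sub (smooth_differentiable hf z) (smooth_differentiable hg z)]
  rfl

theorem dirDeriv_sum {ι : Type*} {s : Finset ι} {f : ι → V → F}
    (hf : ∀ i, ContDiff ℝ ∞ (f i)) (v : V) :
    dirDeriv v (fun z => ∑ i ∈ s, f i z) = fun z => ∑ i ∈ s, dirDeriv v (f i) z := by
  funext z
  simp only [dirDeriv]
  rw [fderiv_fun_sum (fun i _ => smooth_differentiable (hf i) z)]
  simp

theorem dirDeriv_const (c : F) (v : V) : dirDeriv v (fun _ : V => c) = fun _ => 0 := by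
  funext z
  simp [dirDeriv]

theorem dirDeriv_mul {f g : V → ℂ} (hf : ContDiff ℝ ∞ f) (hg : ContDiff ℝ ∞ g) (v : V) :
    dirDeriv v (fun z => f z * g z) = fun z => dirDeriv v f z * g z + f z * dirDeriv v g z := by
  funext z
  simp only [dirDeriv]
  rw [fderiv_fun_mul (smooth_differentiable hf z) (smooth_differentiable hg z)]
  simp [mul_comm, add_comm]

theorem dirDeriv_const_mul {f : V → ℂ} (hf : ContDiff ℝ ∞ f) (c : ℂ) (v : V) :
    dirDeriv v (fun z => c * f z) = fun z => c * dirDeriv v f z := by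
  rw [dirDeriv_mul contDiff_const hf, dirDeriv_const]
  simp

theorem dirDeriv_smul_dir (f : V → F) (t : ℝ) (v : V) :
    dirDeriv (t • v) f = fun z => t • dirDeriv v f z := by
  funext z
  simp [dirDeriv]

theorem dirDeriv_comm {f : V → F} (hf : ContDiff ℝ ∞ f) (v w : V) :
    dirDeriv v (dirDeriv w f) = dirDeriv w (dirDeriv v f) := by
  have key : ∀ v w z, dirDeriv v (dirDeriv w f) z = fderiv ℝ (fderiv ℝ f) z v w := by
    intro v w z
    have hd : DifferentiableAt ℝ (fderiv ℝ f) z :=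
      ((hf.fderiv_right (m := ∞) le_rfl).differentiable (by simp)) z
    simp only [dirDeriv]
    change fderiv ℝ (fun z => fderiv ℝ f z w) z v = _
    rw [fderiv_clm_apply hd (differentiableAt_const w)]
    simp
  funext z
  rw [key, key]
  have h2 : (2 : WithTop ℕ∞) ≤ ∞ := WithTop.coe_le_coe.2 le_top
  exact (hf.contDiffAt.isSymmSndFDerivAt (by simpa using h2)) v w

theorem dirDeriv_comp_affine {f : W → F} (hf : ContDiff ℝ ∞ f) (c : W) (T : V →L[ℝ] W) (v : V) :
    dirDeriv v (fun z => f (c + T z)) = fun z => dirDeriv (T v) f (c + T z) := by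
  funext z
  have h1 : HasFDerivAt (fun z => c + T z) T z := T.hasFDerivAt.const_add c
  have h2 := ((smooth_differentiable hf) (c + T z)).hasFDerivAt.comp z h1
  simp only [dirDeriv]
  exact congrArg (fun A : V →L[ℝ] F => A v) h2.fderiv

theorem contDiff_comp_affine {f : W → F} (hf : ContDiff ℝ ∞ f) (c : W) (T : V →L[ℝ] W) :
    ContDiff ℝ ∞ (fun z => f (c + T z)) :=
  hf.comp (contDiff_const.add T.contDiff)

/-- Iterated directional derivative along the vectors of a list, the head being applied first. -/
def listDeriv (L : List V) (f : V → F) : V → F := L.foldl (fun h v => dirDeriv v h) f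

@[simp] theorem listDeriv_nil (f : V → F) : listDeriv [] f = f := rfl

@[simp] theorem listDeriv_cons (v : V) (L : List V) (f : V → F) :
    listDeriv (v :: L) f = listDeriv L (dirDeriv v f) := rfl

theorem listDeriv_append (L L' : List V) (f : V → F) :
    listDeriv (L ++ L') f = listDeriv L' (listDeriv L f) := List.foldl_append

theorem contDiff_listDeriv (L : List V) {f : V → F} (hf : ContDiff ℝ ∞ f) :
    ContDiff ℝ ∞ (listDeriv L f) := by
  induction L generalizing f with
  | nil => exact hf
  | cons v L ih => exact ih (contDiff_dirDeriv hf v)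

theorem listDeriv_add (L : List V) {f g : V → F} (hf : ContDiff ℝ ∞ f) (hg : ContDiff ℝ ∞ g) :
    listDeriv L (fun z => f z + g z) = fun z => listDeriv L f z + listDeriv L g z := by
  induction L generalizing f g with
  | nil => rfl
  | cons v L ih =>
    simp only [listDeriv_cons, dirDeriv_add hf hg]
    exact ih (contDiff_dirDeriv hf v) (contDiff_dirDeriv hg v)

theorem listDeriv_sub (L : List V) {f g : V → F} (hf : ContDiff ℝ ∞ f) (hg : ContDiff ℝ ∞ g) :
    listDeriv L (fun z => f z - g z) = fun z => listDeriv L f z - listDeriv L g z := by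
  induction L generalizing f g with
  | nil => rfl
  | cons v L ih =>
    simp only [listDeriv_cons, dirDeriv_sub hf hg]
    exact ih (contDiff_dirDeriv hf v) (contDiff_dirDeriv hg v)

theorem listDeriv_sum {ι : Type*} {s : Finset ι} (L : List V) {f : ι → V → F}
    (hf : ∀ i, ContDiff ℝ ∞ (f i)) :
    listDeriv L (fun z => ∑ i ∈ s, f i z) = fun z => ∑ i ∈ s, listDeriv L (f i) z := by
  induction L generalizing f with
  | nil => rfl
  | cons v L ih =>
    simp only [listDeriv_cons, dirDeriv_sum hf]
    exact ih fun i => contDiff_dirDeriv (hf i) v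

theorem listDeriv_const_mul (L : List V) {f : V → ℂ} (hf : ContDiff ℝ ∞ f) (c : ℂ) :
    listDeriv L (fun z => c * f z) = fun z => c * listDeriv L f z := by
  induction L generalizing f with
  | nil => rfl
  | cons v L ih =>
    simp only [listDeriv_cons, dirDeriv_const_mul hf]
    exact ih (contDiff_dirDeriv hf v)

theorem listDeriv_zero (L : List V) : listDeriv L (fun _ : V => (0 : F)) = fun _ => 0 := by
  induction L with
  | nil => rfl
  | cons v L ih => simpa only [listDeriv_cons, dirDeriv_const] using ih

/-- Symmetry of second derivatives. It allows lists of directions to be handled as multi-indices. -/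
theorem listDeriv_perm {L L' : List V} (h : L.Perm L') {f : V → F} (hf : ContDiff ℝ ∞ f) :
    listDeriv L f = listDeriv L' f := by
  induction h generalizing f with
  | nil => rfl
  | cons v _ ih => exact ih (contDiff_dirDeriv hf v)
  | swap v w L => simp only [listDeriv_cons, dirDeriv_comm hf]
  | trans _ _ ih₁ ih₂ => exact (ih₁ hf).trans (ih₂ hf)

theorem listDeriv_comp_affine (L : List V) {f : W → F} (hf : ContDiff ℝ ∞ f) (c : W)
    (T : V →L[ℝ] W) :
    listDeriv L (fun z => f (c + T z)) = fun z => listDeriv (L.map T) f (c + T z) := by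
  induction L generalizing f with
  | nil => rfl
  | cons v L ih =>
    simp only [listDeriv_cons, List.map_cons, dirDeriv_comp_affine hf]
    exact ih (contDiff_dirDeriv hf _)

theorem listDeriv_comp_clm (L : List V) {f : W → F} (hf : ContDiff ℝ ∞ f) (T : V →L[ℝ] W) :
    listDeriv L (fun z => f (T z)) = fun z => listDeriv (L.map T) f (T z) := by
  simpa using listDeriv_comp_affine L hf 0 T

theorem listDeriv_eq_zero_of_mem {L : List V} {f : V → F} (hf : ContDiff ℝ ∞ f)
    (h : ∃ v ∈ L, dirDeriv v f = fun _ => 0) : listDeriv L f = fun _ => 0 := by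
  obtain ⟨v, hv, h0⟩ := h
  obtain ⟨L₁, L₂, rfl⟩ := List.append_of_mem hv
  rw [listDeriv_perm List.perm_middle hf, listDeriv_cons, h0, listDeriv_zero]

/-- Rescaling the directions rescales the derivative. -/
theorem norm_listDeriv_map_smul_le {ι : Type*} (e : ι → V) (t : ι → ℝ) (ht : ∀ i, |t i| ≤ 1)
    (S : List ι) {f : V → ℂ} (hf : ContDiff ℝ ∞ f) (z : V) :
    ‖listDeriv (S.map fun i => t i • e i) f z‖ ≤ ‖listDeriv (S.map e) f z‖ := by
  induction S generalizing f with
  | nil => exact le_rfl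
  | cons i S ih =>
    have h1 : dirDeriv (t i • e i) f = fun z => (t i : ℂ) * dirDeriv (e i) f z := by
      rw [dirDeriv_smul_dir]; simp
    have h2 := contDiff_dirDeriv hf (e i)
    simp only [List.map_cons, listDeriv_cons, h1]
    rw [listDeriv_const_mul _ h2]
    refine le_trans ?_ (ih h2)
    rw [norm_mul, Complex.norm_real]
    exact mul_le_of_le_one_left (norm_nonneg _) (ht i)

/-- Crude pointwise Leibniz bound. -/
theorem norm_listDeriv_mul_le (L : List V) {f g : V → ℂ} (hf : ContDiff ℝ ∞ f)
    (hg : ContDiff ℝ ∞ g) (z : V) {A B : ℝ}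
    (hfA : ∀ S, S.Sublist L → ‖listDeriv S f z‖ ≤ A)
    (hgB : ∀ S, S.Sublist L → ‖listDeriv S g z‖ ≤ B) :
    ‖listDeriv L (fun z => f z * g z) z‖ ≤ 2 ^ L.length * (A * B) := by
  induction L generalizing f g with
  | nil =>
    have h1 := hfA [] (List.Sublist.refl _)
    have h2 := hgB [] (List.Sublist.refl _)
    simp only [listDeriv_nil] at h1 h2 ⊢
    simp only [List.length_nil, pow_zero, one_mul, norm_mul]
    exact mul_le_mul h1 h2 (norm_nonneg _) ((norm_nonneg _).trans h1)
  | cons v L ih =>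
    have hf' := contDiff_dirDeriv hf v
    have hg' := contDiff_dirDeriv hg v
    have e : listDeriv (v :: L) (fun z => f z * g z) = fun z =>
        listDeriv L (fun z => dirDeriv v f z * g z) z
          + listDeriv L (fun z => f z * dirDeriv v g z) z := by
      rw [listDeriv_cons, dirDeriv_mul hf hg]
      exact listDeriv_add L (hf'.mul hg) (hf.mul hg')
    rw [e]
    have b1 := ih hf' hg (fun S hS => hfA (v :: S) (hS.cons_cons v))
      (fun S hS => hgB S (hS.cons v))
    have b2 := ih hf hg' (fun S hS => hfA S (hS.cons v))
      (fun S hS => hgB (v :: S) (hS.cons_cons v))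
    refine (norm_add_le _ _).trans ((add_le_add b1 b2).trans (le_of_eq ?_))
    rw [List.length_cons, pow_succ]
    ring

/-- The derivative of a product of functions, one at a time. -/
theorem dirDeriv_finset_prod {J : Type*} [Fintype J] [DecidableEq J] {F : J → V → ℂ}
    (hF : ∀ j, ContDiff ℝ ∞ (F j)) (v : V) :
    dirDeriv v (fun z => ∏ j, F j z) =
      fun z => ∑ j, ∏ r, Function.update F j (dirDeriv v (F j)) r z := by
  funext z
  have h := HasFDerivAt.finsetProd (u := Finset.univ) (g := F) (x := z)
    (fun j _ => (smooth_differentiable (hF j) z).hasFDerivAt)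
  simp only [dirDeriv]
  rw [h.fderiv]
  simp only [sum_apply, smul_apply, smul_eq_mul]
  refine Finset.sum_congr rfl fun j _ => ?_
  rw [← Finset.mul_prod_erase Finset.univ _ (Finset.mem_univ j)]
  simp only [Function.update_self]
  rw [mul_comm]
  congr 1
  refine Finset.prod_congr rfl fun r hr => ?_
  rw [Function.update_of_ne (Finset.ne_of_mem_erase hr)]

/-- Pointwise Leibniz bound for many factors, each direction acting on at most `K` of them. -/
theorem norm_listDeriv_prod_le {J : Type*} [Fintype J] [DecidableEq J] (L : List V)
    {F : J → V → ℂ} (hF : ∀ j, ContDiff ℝ ∞ (F j)) (hit : J → V → Prop)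
    [∀ j v, Decidable (hit j v)] (K : ℕ) (z : V) {A : J → ℝ}
    (h0 : ∀ j, ∀ v, ¬ hit j v → dirDeriv v (F j) = fun _ => 0)
    (hK : ∀ v ∈ L, (Finset.univ.filter fun j => hit j v).card ≤ K)
    (hA : ∀ j, ∀ S, S.Sublist L → ‖listDeriv S (F j) z‖ ≤ A j) :
    ‖listDeriv L (fun z => ∏ j, F j z) z‖ ≤ (K : ℝ) ^ L.length * ∏ j, A j := by
  induction L generalizing F with
  | nil =>
    simp only [listDeriv_nil, List.length_nil, pow_zero, one_mul, norm_prod]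
    exact Finset.prod_le_prod (fun _ _ => norm_nonneg _)
      fun j _ => hA j [] (List.Sublist.refl _)
  | cons v L ih =>
    have hA0 : ∀ j, 0 ≤ A j := fun j => (norm_nonneg _).trans (hA j [] (List.nil_sublist _))
    have hU : ∀ j r, ContDiff ℝ ∞ (Function.update F j (dirDeriv v (F j)) r) := by
      intro j r
      by_cases h : r = j
      · subst h; simpa using contDiff_dirDeriv (hF r) v
      · simpa [Function.update_of_ne h] using hF r
    rw [listDeriv_cons, dirDeriv_finset_prod hF,
      listDeriv_sum L (fun j => contDiff_prod fun r _ => hU j r)]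
    have hterm : ∀ j, ‖listDeriv L
        (fun z => ∏ r, Function.update F j (dirDeriv v (F j)) r z) z‖
          ≤ if hit j v then (K : ℝ) ^ L.length * ∏ j, A j else 0 := by
      intro j
      split_ifs with hj
      · refine ih (hU j) ?_ (fun w hw => hK w (List.mem_cons_of_mem _ hw)) ?_
        · intro r w hw
          by_cases h : r = j
          · subst h
            -- Derivatives commute, so a direction that kills a factor also kills its derivatives.
            rw [Function.update_self, dirDeriv_comm (hF r), h0 r w hw, dirDeriv_const]
          · rw [Function.update_of_ne h]; exact h0 r w hw
        · intro r S hS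
          by_cases h : r = j
          · subst h
            rw [Function.update_self]; exact hA r (v :: S) (hS.cons_cons v)
          · rw [Function.update_of_ne h]; exact hA r S (hS.cons v)
      · have : (fun z => ∏ r, Function.update F j (dirDeriv v (F j)) r z) = fun _ => 0 := by
          funext z
          refine Finset.prod_eq_zero (Finset.mem_univ j) ?_
          rw [Function.update_self, h0 j v hj]
        rw [this, listDeriv_zero]; simp
    refine (norm_sum_le _ _).trans ((Finset.sum_le_sum fun j _ => hterm j).trans ?_)
    -- Only the factors hit by `v` contribute, so one derivative costs `K` and not the number of
    -- factors.
    rw [← Finset.sum_filter, Finset.sum_const, nsmul_eq_mul, List.length_cons, pow_succ]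
    have h1 : ((Finset.univ.filter fun j => hit j v).card : ℝ) ≤ K := by
      exact_mod_cast hK v List.mem_cons_self
    have h2 : 0 ≤ (K : ℝ) ^ L.length * ∏ j, A j :=
      mul_nonneg (by positivity) (Finset.prod_nonneg fun j _ => hA0 j)
    calc _ ≤ (K : ℝ) * ((K : ℝ) ^ L.length * ∏ j, A j) := mul_le_mul_of_nonneg_right h1 h2
      _ = _ := by ring

end ListDeriv

/-- Turns constants depending on a list of directions into uniform ones, by taking a maximum. -/
theorem finite_setOf_list {X : Type*} (m : ℕ) {B : Set X} (hB : B.Finite) :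
    {L : List X | L.length ≤ m ∧ ∀ v ∈ L, v ∈ B}.Finite := by
  have := hB.to_subtype
  refine ((List.finite_length_le B m).image (List.map Subtype.val)).subset ?_
  rintro L ⟨h1, h2⟩
  exact ⟨L.pmap (fun v h => ⟨v, h⟩) h2, by simpa using h1, by simp [List.map_pmap]⟩

/-! ### Derivatives of the weights (1 + |z|²)^{-N}. -/

section BoundedAlgebra

variable {d : ℕ}

/-- The function `(1 + |z|²)⁻¹`, with complex values. -/
def invBracket (z : E d) : ℂ := (((1 + ‖z‖ ^ 2)⁻¹ : ℝ) : ℂ)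

/-- The algebra generated by `(1 + |z|²)⁻¹` and `⟨w, z⟩ (1 + |z|²)⁻¹`. -/
inductive InvBracketAlg : (E d → ℂ) → Prop
  | const (c : ℂ) : InvBracketAlg fun _ => c
  | inv : InvBracketAlg invBracket
  | coord (w : E d) : InvBracketAlg fun z => ((inner ℝ w z : ℝ) : ℂ) * invBracket z
  | add {f g : E d → ℂ} : InvBracketAlg f → InvBracketAlg g → InvBracketAlg fun z => f z + g z
  | mul {f g : E d → ℂ} : InvBracketAlg f → InvBracketAlg g → InvBracketAlg fun z => f z * g z

theorem norm_invBracket (z : E d) : ‖invBracket z‖ = (1 + ‖z‖ ^ 2)⁻¹ := by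
  rw [invBracket, Complex.norm_real, Real.norm_of_nonneg (by positivity)]

theorem contDiff_invBracket : ContDiff ℝ ∞ (invBracket : E d → ℂ) :=
  Complex.ofRealCLM.contDiff.comp
    ((contDiff_const.add (contDiff_norm_sq ℝ)).inv fun z => by positivity)

theorem contDiff_inner_ofReal (w : E d) : ContDiff ℝ ∞ fun z : E d => ((inner ℝ w z : ℝ) : ℂ) :=
  Complex.ofRealCLM.contDiff.comp (innerSL ℝ w).contDiff

theorem dirDeriv_inner (v w : E d) :
    dirDeriv v (fun z : E d => ((inner ℝ w z : ℝ) : ℂ)) = fun _ => ((inner ℝ w v : ℝ) : ℂ) := by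
  funext z
  have h := (Complex.ofRealCLM.comp (innerSL ℝ w)).hasFDerivAt (x := z)
  have e : (fun z : E d => ((inner ℝ w z : ℝ) : ℂ)) = Complex.ofRealCLM.comp (innerSL ℝ w) := by
    funext z; simp
  rw [e, dirDeriv, h.fderiv]
  simp

theorem dirDeriv_invBracket (v : E d) :
    dirDeriv v (invBracket : E d → ℂ) =
      fun z => -2 * ((inner ℝ v z : ℝ) : ℂ) * invBracket z * invBracket z := by
  funext z
  have hpos : (1 + ‖z‖ ^ 2) ≠ 0 := by positivity
  have h1 : HasFDerivAt (fun z : E d => 1 + ‖z‖ ^ 2) (2 • innerSL ℝ z) z :=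
    (hasStrictFDerivAt_norm_sq z).hasFDerivAt.const_add 1
  have h2 := (hasDerivAt_inv hpos).comp_hasFDerivAt z h1
  have h3 := Complex.ofRealCLM.hasFDerivAt.comp z h2
  have e : (invBracket : E d → ℂ) = Complex.ofRealCLM ∘ (Inv.inv ∘ fun z : E d => 1 + ‖z‖ ^ 2) := by
    funext z; simp [invBracket]
  rw [dirDeriv, e, h3.fderiv]
  rw [← e]
  simp only [ContinuousLinearMap.comp_apply, smul_apply, innerSL_apply_apply, invBracket,
    Complex.ofRealCLM_apply, real_inner_comm v z, smul_eq_mul, nsmul_eq_mul]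
  push_cast
  rw [← inv_pow]
  ring

theorem InvBracketAlg.contDiff {f : E d → ℂ} (hf : InvBracketAlg f) : ContDiff ℝ ∞ f := by
  induction hf with
  | const c => exact contDiff_const
  | inv => exact contDiff_invBracket
  | coord w => exact (contDiff_inner_ofReal w).mul contDiff_invBracket
  | add _ _ h₁ h₂ => exact h₁.add h₂
  | mul _ _ h₁ h₂ => exact h₁.mul h₂

theorem InvBracketAlg.bounded {f : E d → ℂ} (hf : InvBracketAlg f) : ∃ C, ∀ z, ‖f z‖ ≤ C := by
  induction hf with
  | const c => exact ⟨‖c‖, fun _ => le_rfl⟩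
  | inv =>
    refine ⟨1, fun z => ?_⟩
    rw [norm_invBracket]
    exact inv_le_one_of_one_le₀ (by nlinarith [sq_nonneg ‖z‖])
  | coord w =>
    refine ⟨‖w‖, fun z => ?_⟩
    rw [norm_mul, norm_invBracket, Complex.norm_real, ← div_eq_mul_inv,
      div_le_iff₀ (by positivity)]
    refine (norm_inner_le_norm w z).trans (mul_le_mul_of_nonneg_left ?_ (norm_nonneg _))
    nlinarith [sq_nonneg (‖z‖ - 1)]
  | add _ _ h₁ h₂ =>
    obtain ⟨C₁, h₁⟩ := h₁
    obtain ⟨C₂, h₂⟩ := h₂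
    exact ⟨C₁ + C₂, fun z => (norm_add_le _ _).trans (add_le_add (h₁ z) (h₂ z))⟩
  | mul _ _ h₁ h₂ =>
    obtain ⟨C₁, h₁⟩ := h₁
    obtain ⟨C₂, h₂⟩ := h₂
    refine ⟨C₁ * C₂, fun z => ?_⟩
    rw [norm_mul]
    exact mul_le_mul (h₁ z) (h₂ z) (norm_nonneg _) ((norm_nonneg _).trans (h₁ z))

/-- The derivative of a generator is a polynomial in generators, and the Leibniz rule does the rest.
Every element being bounded, so are all derivatives. -/
theorem InvBracketAlg.dirDeriv {f : E d → ℂ} (hf : InvBracketAlg f) (v : E d) :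
    InvBracketAlg (dirDeriv v f) := by
  have hinv : InvBracketAlg (NegDefSymbol.dirDeriv v (invBracket : E d → ℂ)) := by
    rw [dirDeriv_invBracket]
    convert ((const (-2 : ℂ)).mul (coord v)).mul inv using 2
    ring
  induction hf with
  | const c => rw [dirDeriv_const]; exact const 0
  | inv => exact hinv
  | coord w =>
    rw [dirDeriv_mul (contDiff_inner_ofReal w) contDiff_invBracket, dirDeriv_inner,
      dirDeriv_invBracket]
    convert ((const ((inner ℝ w v : ℝ) : ℂ)).mul inv).add
      ((const (-2 : ℂ)).mul ((coord w).mul (coord v))) using 2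
    ring
  | add h₁ h₂ i₁ i₂ => rw [dirDeriv_add h₁.contDiff h₂.contDiff]; exact i₁.add i₂
  | mul h₁ h₂ i₁ i₂ =>
    rw [dirDeriv_mul h₁.contDiff h₂.contDiff]; exact (i₁.mul h₂).add (h₁.mul i₂)

theorem dirDeriv_invBracket_pow (N : ℕ) (v : E d) :
    dirDeriv v (fun z : E d => invBracket z ^ N) =
      fun z => invBracket z ^ N * (-2 * N * (((inner ℝ v z : ℝ) : ℂ) * invBracket z)) := by
  induction N with
  | zero => simpa using dirDeriv_const (1 : ℂ) v
  | succ N ih =>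
    simp only [pow_succ]
    rw [dirDeriv_mul (contDiff_invBracket.pow N) contDiff_invBracket, ih, dirDeriv_invBracket]
    funext z
    push_cast
    ring

/-- The logarithmic derivative of the weight lies in the algebra, so differentiation only changes
the bounded cofactor. -/
theorem listDeriv_invBracket_pow (N : ℕ) (L : List (E d)) {f : E d → ℂ} (hf : InvBracketAlg f) :
    ∃ h, InvBracketAlg h ∧ listDeriv L (fun z => invBracket z ^ N * f z) =
      fun z => invBracket z ^ N * h z := by
  induction L generalizing f with
  | nil => exact ⟨f, hf, rfl⟩
  | cons v L ih =>
    rw [listDeriv_cons, dirDeriv_mul (contDiff_invBracket.pow N) hf.contDiff,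
      dirDeriv_invBracket_pow]
    obtain ⟨h, hh, e⟩ := ih (f := fun z => (-2 * N * (((inner ℝ v z : ℝ) : ℂ) * invBracket z)) * f z
      + dirDeriv v f z)
      ((((InvBracketAlg.const (-2 * N : ℂ)).mul (.coord v)).mul hf).add (hf.dirDeriv v))
    refine ⟨h, hh, ?_⟩
    rw [← e]
    congr 1
    funext z
    ring

/-- Derivatives of `(1 + |z|²)^{-N}` are controlled by the function itself. -/
theorem norm_listDeriv_invBracket_pow_le (N : ℕ) (L : List (E d)) :
    ∃ C, 0 ≤ C ∧ ∀ z, ‖listDeriv L (fun z => invBracket z ^ N) z‖ ≤ C * ‖invBracket z‖ ^ N := by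
  obtain ⟨h, hh, e⟩ := listDeriv_invBracket_pow N L (.const (1 : ℂ))
  obtain ⟨C, hC⟩ := hh.bounded
  simp only [mul_one] at e
  refine ⟨C, (norm_nonneg _).trans (hC 0), fun z => ?_⟩
  rw [e, norm_mul, norm_pow, mul_comm]
  exact mul_le_mul_of_nonneg_right (hC z) (by positivity)

theorem norm_listDeriv_invBracket_pow_le_uniform (N m : ℕ) (B : Set (E d)) (hB : B.Finite) :
    ∃ C, 1 ≤ C ∧ ∀ L : List (E d), L.length ≤ m → (∀ v ∈ L, v ∈ B) → ∀ z,
      ‖listDeriv L (fun z => invBracket z ^ N) z‖ ≤ C * ‖invBracket z‖ ^ N := by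
  choose c hc0 hc using norm_listDeriv_invBracket_pow_le (d := d) N
  obtain ⟨C, hC⟩ := ((finite_setOf_list m hB).image c).bddAbove
  refine ⟨max 1 C, le_max_left _ _, fun L h1 h2 z => (hc L z).trans ?_⟩
  exact mul_le_mul_of_nonneg_right ((hC ⟨L, ⟨h1, h2⟩, rfl⟩).trans (le_max_right _ _))
    (by positivity)

end BoundedAlgebra

/-! ### Polynomial growth, rapid decay and Schwartz cut-offs. -/

section Growth

variable {V : Type*} [NormedAddCommGroup V] [NormedSpace ℝ V]

/-- Smooth functions all of whose derivatives along directions from `B` grow at most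
polynomially. -/
structure TempGrowth (B : Set V) (u : V → ℂ) : Prop where
  smooth : ContDiff ℝ ∞ u
  bound : ∀ S : List V, (∀ v ∈ S, v ∈ B) →
    ∃ (k : ℕ) (C : ℝ), ∀ z, ‖listDeriv S u z‖ ≤ C * (1 + ‖z‖) ^ k

/-- Smooth functions all of whose derivatives along directions from `B` decay rapidly. -/
structure RapidDecay (B : Set V) (u : V → ℂ) : Prop where
  smooth : ContDiff ℝ ∞ u
  bound : ∀ S : List V, (∀ v ∈ S, v ∈ B) → ∀ k : ℕ,
    ∃ C : ℝ, ∀ z, (1 + ‖z‖) ^ k * ‖listDeriv S u z‖ ≤ C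

variable {B : Set V} {u w : V → ℂ}

theorem TempGrowth.dirDeriv (hu : TempGrowth B u) {v : V} (hv : v ∈ B) :
    TempGrowth B (dirDeriv v u) :=
  ⟨contDiff_dirDeriv hu.smooth v, fun S hS => hu.bound (v :: S) (List.forall_mem_cons.2 ⟨hv, hS⟩)⟩

theorem RapidDecay.dirDeriv (hu : RapidDecay B u) {v : V} (hv : v ∈ B) :
    RapidDecay B (dirDeriv v u) :=
  ⟨contDiff_dirDeriv hu.smooth v, fun S hS => hu.bound (v :: S) (List.forall_mem_cons.2 ⟨hv, hS⟩)⟩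

theorem RapidDecay.sub (hu : RapidDecay B u) (hw : RapidDecay B w) :
    RapidDecay B fun z => u z - w z := by
  refine ⟨hu.smooth.sub hw.smooth, fun S hS k => ?_⟩
  obtain ⟨C₁, h₁⟩ := hu.bound S hS k
  obtain ⟨C₂, h₂⟩ := hw.bound S hS k
  refine ⟨C₁ + C₂, fun z => ?_⟩
  rw [listDeriv_sub S hu.smooth hw.smooth]
  calc _ ≤ (1 + ‖z‖) ^ k * (‖listDeriv S u z‖ + ‖listDeriv S w z‖) := by
        gcongr; exact norm_sub_le _ _
    _ ≤ C₁ + C₂ := by rw [mul_add]; exact add_le_add (h₁ z) (h₂ z)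

theorem RapidDecay.sum {ι : Type*} {s : Finset ι} {u : ι → V → ℂ}
    (hu : ∀ i, RapidDecay B (u i)) : RapidDecay B fun z => ∑ i ∈ s, u i z := by
  refine ⟨ContDiff.sum fun i _ => (hu i).smooth, fun S hS k => ?_⟩
  choose C h using fun i => (hu i).bound S hS k
  refine ⟨∑ i ∈ s, C i, fun z => ?_⟩
  rw [listDeriv_sum S fun i => (hu i).smooth]
  calc _ ≤ (1 + ‖z‖) ^ k * ∑ i ∈ s, ‖listDeriv S (u i) z‖ := by
        gcongr; exact norm_sum_le _ _
    _ ≤ _ := by rw [Finset.mul_sum]; exact Finset.sum_le_sum fun i _ => h i z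

/-- Leibniz, by induction on the directions with both factors free. This makes the regularised
integrand rapidly decaying, so that no boundary terms arise. -/
theorem TempGrowth.mul_rapidDecay (hu : TempGrowth B u) (hw : RapidDecay B w) :
    RapidDecay B fun z => u z * w z := by
  refine ⟨hu.smooth.mul hw.smooth, fun S => ?_⟩
  induction S generalizing u w with
  | nil =>
    intro _ k
    obtain ⟨n, C₁, h₁⟩ := hu.bound [] (by simp)
    obtain ⟨C₂, h₂⟩ := hw.bound [] (by simp) (k + n)
    simp only [listDeriv_nil] at h₁ h₂ ⊢
    have hC₁ : 0 ≤ C₁ := by simpa using (norm_nonneg _).trans (h₁ 0)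
    refine ⟨C₁ * C₂, fun z => ?_⟩
    calc (1 + ‖z‖) ^ k * ‖u z * w z‖ = (1 + ‖z‖) ^ k * ‖w z‖ * ‖u z‖ := by rw [norm_mul]; ring
      _ ≤ (1 + ‖z‖) ^ k * ‖w z‖ * (C₁ * (1 + ‖z‖) ^ n) := by gcongr; exact h₁ z
      _ = C₁ * ((1 + ‖z‖) ^ (k + n) * ‖w z‖) := by rw [pow_add]; ring
      _ ≤ C₁ * C₂ := mul_le_mul_of_nonneg_left (h₂ z) hC₁
  | cons v S ih =>
    intro hS k
    obtain ⟨hv, hS⟩ := List.forall_mem_cons.1 hS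
    obtain ⟨C₁, h₁⟩ := ih (hu.dirDeriv hv) hw hS k
    obtain ⟨C₂, h₂⟩ := ih hu (hw.dirDeriv hv) hS k
    refine ⟨C₁ + C₂, fun z => ?_⟩
    rw [listDeriv_cons, dirDeriv_mul hu.smooth hw.smooth,
      listDeriv_add S ((contDiff_dirDeriv hu.smooth v).mul hw.smooth)
        (hu.smooth.mul (contDiff_dirDeriv hw.smooth v))]
    refine (mul_le_mul_of_nonneg_left (norm_add_le _ _) (by positivity)).trans ?_
    rw [mul_add]
    exact add_le_add (h₁ z) (h₂ z)

theorem tempGrowth_invBracket_comp {d : ℕ} (T : V →L[ℝ] E d) :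
    TempGrowth B fun z => invBracket (T z) := by
  refine ⟨contDiff_invBracket.comp T.contDiff, fun S _ => ?_⟩
  rw [listDeriv_comp_clm S contDiff_invBracket T]
  obtain ⟨C, hC, h⟩ := norm_listDeriv_invBracket_pow_le 1 (S.map T)
  refine ⟨0, C, fun z => ?_⟩
  have h1 := h (T z)
  simp only [pow_one] at h1
  refine h1.trans ?_
  rw [pow_zero, norm_invBracket]
  exact mul_le_mul_of_nonneg_left (inv_le_one_of_one_le₀ (by nlinarith [sq_nonneg ‖T z‖])) hC

theorem tempGrowth_clm (T : V →L[ℝ] ℝ) : TempGrowth B fun z => (T z : ℂ) := by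
  have hs : ContDiff ℝ ∞ fun z => (T z : ℂ) := Complex.ofRealCLM.contDiff.comp T.contDiff
  refine ⟨hs, fun S _ => ?_⟩
  have hd : ∀ v, dirDeriv v (fun z => (T z : ℂ)) = fun _ => (T v : ℂ) := by
    intro v
    funext z
    have h := (Complex.ofRealCLM.comp T).hasFDerivAt (x := z)
    exact congrArg (fun A : V →L[ℝ] ℂ => A v) h.fderiv
  match S with
  | [] =>
    refine ⟨1, ‖T‖, fun z => ?_⟩
    rw [listDeriv_nil, Complex.norm_real, pow_one]
    exact (T.le_opNorm z).trans (mul_le_mul_of_nonneg_left (by linarith) (norm_nonneg _))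
  | [v] =>
    refine ⟨0, |T v|, fun z => ?_⟩
    simp [hd]
  | v :: w :: S =>
    refine ⟨0, 0, fun z => ?_⟩
    simp only [listDeriv_cons, hd, dirDeriv_const, listDeriv_zero]
    simp

theorem RapidDecay.integrable [FiniteDimensional ℝ V] [MeasurableSpace V] [BorelSpace V]
    {μ : MeasureTheory.Measure V} [μ.IsAddHaarMeasure] (hu : RapidDecay B u) :
    MeasureTheory.Integrable u μ := by
  obtain ⟨C, hC⟩ := hu.bound [] (by simp) (Module.finrank ℝ V + 1)
  have h1 : MeasureTheory.Integrable
      (fun z : V => C * (1 + ‖z‖) ^ (-((Module.finrank ℝ V + 1 : ℕ) : ℝ))) μ :=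
    (integrable_one_add_norm (by push_cast; linarith)).const_mul C
  refine h1.mono' hu.smooth.continuous.aestronglyMeasurable (.of_forall fun z => ?_)
  rw [Real.rpow_neg (by positivity), Real.rpow_natCast, ← div_eq_mul_inv,
    le_div_iff₀ (by positivity), mul_comm]
  exact hC z

theorem listDeriv_schwartz (χ : 𝓢(V, ℂ)) (S : List V) :
    ∃ φ : 𝓢(V, ℂ), listDeriv S χ = φ := by
  induction S generalizing χ with
  | nil => exact ⟨χ, rfl⟩
  | cons v S ih => exact ih (LineDeriv.lineDerivOp v χ)

/-- Each derivative brings out a factor ε; this is what makes derivatives of the cut-off vanish in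
the limit. -/
theorem listDeriv_comp_smul {f : V → ℂ} (hf : ContDiff ℝ ∞ f) (ε : ℝ) (S : List V) :
    listDeriv S (fun z => f (ε • z)) =
      fun z => ((ε ^ S.length : ℝ) : ℂ) * listDeriv S f (ε • z) := by
  induction S generalizing f with
  | nil => simp
  | cons v S ih =>
    have h1 : dirDeriv v (fun z => f (ε • z)) = fun z => (ε : ℂ) * dirDeriv v f (ε • z) := by
      have := dirDeriv_comp_affine hf 0 (ε • ContinuousLinearMap.id ℝ V) v
      simp only [zero_add, smul_apply, ContinuousLinearMap.id_apply,
        dirDeriv_smul_dir] at this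
      rw [this]; simp
    have hs : ContDiff ℝ ∞ fun z => dirDeriv v f (ε • z) :=
      (contDiff_dirDeriv hf v).comp (contDiff_const.smul contDiff_id)
    rw [listDeriv_cons, h1, listDeriv_const_mul S hs, ih (contDiff_dirDeriv hf v)]
    funext z
    simp only [listDeriv_cons, List.length_cons, pow_succ]
    push_cast
    ring

theorem norm_schwartz_le (φ : 𝓢(V, ℂ)) (k : ℕ) : ∃ C, ∀ z, (1 + ‖z‖) ^ k * ‖φ z‖ ≤ C := by
  have h := SchwartzMap.one_add_le_sup_seminorm_apply (𝕜 := ℝ) (m := (k, 0)) (k := k) (n := 0)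
    le_rfl le_rfl φ
  exact ⟨_, fun z => by simpa only [norm_iteratedFDeriv_zero] using h z⟩

theorem contDiff_schwartz_comp_smul (χ : 𝓢(V, ℂ)) (ε : ℝ) : ContDiff ℝ ∞ fun z => χ (ε • z) :=
  (χ.smooth ⊤).comp (contDiff_const_smul ε)

theorem rapidDecay_schwartz_comp_smul (χ : 𝓢(V, ℂ)) {ε : ℝ} (hε : 0 < ε) :
    RapidDecay B fun z => χ (ε • z) := by
  refine ⟨contDiff_schwartz_comp_smul χ ε, fun S _ k => ?_⟩
  obtain ⟨φ, hφ⟩ := listDeriv_schwartz χ S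
  obtain ⟨C, hC⟩ := norm_schwartz_le φ k
  rw [listDeriv_comp_smul (χ.smooth ⊤), hφ]
  refine ⟨(1 + ε⁻¹) ^ k * (|ε ^ S.length| * C), fun z => ?_⟩
  have h1 : 1 + ‖z‖ ≤ (1 + ε⁻¹) * (1 + ‖ε • z‖) := by
    rw [norm_smul, Real.norm_of_nonneg hε.le]
    have : ε⁻¹ * (ε * ‖z‖) = ‖z‖ := by field_simp
    have h2 : 0 ≤ ε * ‖z‖ := by positivity
    have h3 : 0 < ε⁻¹ := by positivity
    nlinarith
  rw [norm_mul, Complex.norm_real, Real.norm_eq_abs]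
  calc _ ≤ ((1 + ε⁻¹) * (1 + ‖ε • z‖)) ^ k * (|ε ^ S.length| * ‖φ (ε • z)‖) := by gcongr
    _ = (1 + ε⁻¹) ^ k * (|ε ^ S.length| * ((1 + ‖ε • z‖) ^ k * ‖φ (ε • z)‖)) := by
      rw [mul_pow]; ring
    _ ≤ _ := by gcongr; exact hC _

end Growth

/-! ### Integration by parts with the operators 1 - Δ. -/

section IterLap

variable {V : Type*} [NormedAddCommGroup V] [NormedSpace ℝ V] {d : ℕ} {J : Type*}

/-- `(1 - ∑ i, ∂_{w i}²) u`. -/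
def oneSubLap (w : Fin d → V) (u : V → ℂ) : V → ℂ :=
  fun z => u z - ∑ i, dirDeriv (w i) (dirDeriv (w i) u) z

/-- The composition of the operators `1 - ∑ i, ∂_{w j i}²`, for `j` in a list. -/
def iterLap (w : J → Fin d → V) (l : List J) (u : V → ℂ) : V → ℂ :=
  l.foldr (fun j h => oneSubLap (w j) h) u

@[simp] theorem iterLap_nil (w : J → Fin d → V) (u : V → ℂ) : iterLap w [] u = u := rfl

@[simp] theorem iterLap_cons (w : J → Fin d → V) (j : J) (l : List J) (u : V → ℂ) :
    iterLap w (j :: l) u = oneSubLap (w j) (iterLap w l u) := rfl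

theorem contDiff_oneSubLap (w : Fin d → V) {u : V → ℂ} (hu : ContDiff ℝ ∞ u) :
    ContDiff ℝ ∞ (oneSubLap w u) :=
  hu.sub (ContDiff.sum fun _ _ => contDiff_dirDeriv (contDiff_dirDeriv hu _) _)

theorem contDiff_iterLap (w : J → Fin d → V) (l : List J) {u : V → ℂ} (hu : ContDiff ℝ ∞ u) :
    ContDiff ℝ ∞ (iterLap w l u) := by
  induction l with
  | nil => exact hu
  | cons j l ih => exact contDiff_oneSubLap _ ih

theorem oneSubLap_sub (w : Fin d → V) {u v : V → ℂ} (hu : ContDiff ℝ ∞ u)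
    (hv : ContDiff ℝ ∞ v) :
    oneSubLap w (fun z => u z - v z) = fun z => oneSubLap w u z - oneSubLap w v z := by
  funext z
  simp only [oneSubLap, dirDeriv_sub hu hv,
    dirDeriv_sub (contDiff_dirDeriv hu _) (contDiff_dirDeriv hv _), Finset.sum_sub_distrib]
  ring

theorem iterLap_sub (w : J → Fin d → V) (l : List J) {u v : V → ℂ} (hu : ContDiff ℝ ∞ u)
    (hv : ContDiff ℝ ∞ v) :
    iterLap w l (fun z => u z - v z) = fun z => iterLap w l u z - iterLap w l v z := by
  induction l with
  | nil => rfl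
  | cons j l ih =>
    rw [iterLap_cons, ih, oneSubLap_sub _ (contDiff_iterLap w l hu) (contDiff_iterLap w l hv)]
    rfl

theorem oneSubLap_mul_left (w : Fin d → V) {q u : V → ℂ} (hq : ContDiff ℝ ∞ q)
    (hu : ContDiff ℝ ∞ u) (h0 : ∀ i, dirDeriv (w i) q = fun _ => 0) :
    oneSubLap w (fun z => q z * u z) = fun z => q z * oneSubLap w u z := by
  have key : ∀ i, ∀ {f : V → ℂ}, ContDiff ℝ ∞ f →
      dirDeriv (w i) (fun z => q z * f z) = fun z => q z * dirDeriv (w i) f z := by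
    intro i f hf
    rw [dirDeriv_mul hq hf, h0]
    simp
  funext z
  simp only [oneSubLap, key _ hu, key _ (contDiff_dirDeriv hu _), mul_sub, Finset.mul_sum]

theorem RapidDecay.oneSubLap {B : Set V} {w : Fin d → V} {u : V → ℂ} (hu : RapidDecay B u)
    (hw : ∀ i, w i ∈ B) : RapidDecay B (oneSubLap w u) :=
  hu.sub (RapidDecay.sum fun i => (hu.dirDeriv (hw i)).dirDeriv (hw i))

theorem RapidDecay.iterLap {B : Set V} {w : J → Fin d → V} {u : V → ℂ} (hu : RapidDecay B u)
    (hw : ∀ j i, w j i ∈ B) (l : List J) : RapidDecay B (iterLap w l u) := by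
  induction l with
  | nil => exact hu
  | cons j l ih => exact ih.oneSubLap (hw j)

/-- The multi-indices entering `iterLap w l` have order at most `2 * l.count j` in block `j`. -/
theorem norm_listDeriv_iterLap_le [DecidableEq J] (w : J → Fin d → V) (l : List J) {u : V → ℂ}
    (hu : ContDiff ℝ ∞ u) (S : List V) (z : V) {A : ℝ}
    (hA : ∀ T : List (J × Fin d), (∀ j, T.countP (fun p => p.1 = j) ≤ 2 * l.count j) →
      ‖listDeriv (T.map (fun p => w p.1 p.2) ++ S) u z‖ ≤ A) :
    ‖listDeriv S (iterLap w l u) z‖ ≤ ((d : ℝ) + 1) ^ l.length * A := by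
  induction l generalizing S with
  | nil => simpa using hA [] (by simp)
  | cons j l ih =>
    have hs := contDiff_iterLap w l hu
    have e : listDeriv S (iterLap w (j :: l) u) = fun z => listDeriv S (iterLap w l u) z
        - ∑ i, listDeriv (w j i :: w j i :: S) (iterLap w l u) z := by
      have hd := fun i => contDiff_dirDeriv (contDiff_dirDeriv hs (w j i)) (w j i)
      rw [iterLap_cons]
      unfold oneSubLap
      rw [listDeriv_sub S hs (ContDiff.sum fun i _ => hd i), listDeriv_sum S hd]
      rfl
    have b0 : ‖listDeriv S (iterLap w l u) z‖ ≤ ((d : ℝ) + 1) ^ l.length * A := by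
      refine ih S fun T hT => hA T fun r => (hT r).trans ?_
      exact Nat.mul_le_mul_left _ (List.count_le_count_cons)
    have b1 : ∀ i, ‖listDeriv (w j i :: w j i :: S) (iterLap w l u) z‖
        ≤ ((d : ℝ) + 1) ^ l.length * A := by
      intro i
      refine ih _ fun T hT => ?_
      -- The two new derivatives fall in block `j`, whose allowance grows by two when `j` joins the
      -- list.
      have := hA (T ++ [(j, i), (j, i)]) fun r => ?_
      · simpa using this
      · have h := hT r
        rw [List.countP_append, List.count_cons]
        by_cases hr : j = r
        · subst hr; simp; omega
        · simp [hr]; omega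
    rw [e]
    refine (norm_sub_le _ _).trans ((add_le_add b0 ((norm_sum_le _ _).trans
      (Finset.sum_le_sum fun i _ => b1 i))).trans (le_of_eq ?_))
    rw [Finset.sum_const, Finset.card_univ, Fintype.card_fin, List.length_cons, pow_succ,
      nsmul_eq_mul]
    ring

theorem contDiff_invBracket_comp (T : V →L[ℝ] E d) : ContDiff ℝ ∞ fun z => invBracket (T z) :=
  contDiff_invBracket.comp T.contDiff

/-- The product of the weights `(1 + |T j z|²)⁻¹`, for `j` in a list. -/
def weightProd (T : J → V →L[ℝ] E d) (l : List J) (z : V) : ℂ :=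
  (l.map fun j => invBracket (T j z)).prod

theorem contDiff_weightProd (T : J → V →L[ℝ] E d) (l : List J) :
    ContDiff ℝ ∞ (weightProd T l) := by
  induction l with
  | nil => exact contDiff_const
  | cons j l ih =>
    have : weightProd T (j :: l) = fun z => invBracket (T j z) * weightProd T l z := by
      funext z; simp [weightProd]
    rw [this]
    exact (contDiff_invBracket_comp (T j)).mul ih

theorem RapidDecay.weightProd_mul {B : Set V} {u : V → ℂ} (hu : RapidDecay B u)
    (T : J → V →L[ℝ] E d) (l : List J) :
    RapidDecay B fun z => weightProd T l z * u z := by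
  induction l with
  | nil => simpa [weightProd] using hu
  | cons j l ih =>
    simp only [weightProd, List.map_cons, List.prod_cons, mul_assoc]
    exact (tempGrowth_invBracket_comp (T j)).mul_rapidDecay ih

theorem dirDeriv_weightProd_eq_zero (T : J → V →L[ℝ] E d) (l : List J) {v : V}
    (hv : ∀ j, T j v = 0) : dirDeriv v (weightProd T l) = fun _ => 0 := by
  induction l with
  | nil => exact dirDeriv_const 1 v
  | cons j l ih =>
    have h1 : weightProd T (j :: l) = fun z => invBracket (T j z) * weightProd T l z := by
      funext z; simp [weightProd]
    have h2 := listDeriv_comp_clm [v] (contDiff_invBracket (d := d)) (T j)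
    simp only [listDeriv_cons, listDeriv_nil, List.map_cons, List.map_nil, hv] at h2
    rw [h1, dirDeriv_mul (contDiff_invBracket_comp (T j)) (contDiff_weightProd T l), ih, h2]
    funext z
    simp [dirDeriv]

variable [FiniteDimensional ℝ V] [MeasurableSpace V] [BorelSpace V]
  {μ : MeasureTheory.Measure V} [μ.IsAddHaarMeasure] {B : Set V} {e u : V → ℂ}

theorem RapidDecay.integrable_mul (hu : RapidDecay B u) (he : Continuous e)
    (he1 : ∀ z, ‖e z‖ ≤ 1) : MeasureTheory.Integrable (fun z => e z * u z) μ :=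
  hu.integrable.bdd_mul he.aestronglyMeasurable (.of_forall he1)

/-- Integration by parts against a phase `e` with `∂_v e = -i T e`. -/
theorem integral_phase_mul (hu : RapidDecay B u) (he : ContDiff ℝ ∞ e) (he1 : ∀ z, ‖e z‖ ≤ 1)
    {v : V} (hv : v ∈ B) (T : V →L[ℝ] ℝ)
    (hT : dirDeriv v e = fun z => -Complex.I * (T z : ℂ) * e z) :
    ∫ z, e z * ((T z : ℂ) * u z) ∂μ = -Complex.I * ∫ z, e z * dirDeriv v u z ∂μ := by
  have hTu := (tempGrowth_clm (B := B) T).mul_rapidDecay hu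
  have i1 := hTu.integrable_mul (μ := μ) he.continuous he1
  have e1 : ∀ z, fderiv ℝ e z v * u z = -Complex.I * (e z * ((T z : ℂ) * u z)) := by
    intro z
    have := congrFun hT z
    rw [dirDeriv] at this
    rw [this]; ring
  have h := integral_mul_fderiv_eq_neg_fderiv_mul_of_integrable (μ := μ) (f := e) (g := u) (v := v)
    (by simp only [e1]; exact i1.const_mul _)
    ((hu.dirDeriv hv).integrable_mul he.continuous he1)
    (hu.integrable_mul he.continuous he1)
    (fun z _ => smooth_differentiable he z) (fun z _ => smooth_differentiable hu.smooth z)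
  simp only [e1, MeasureTheory.integral_const_mul] at h
  change ∫ z, e z * dirDeriv v u z ∂μ = _ at h
  rw [h]
  linear_combination (∫ z, e z * ((T z : ℂ) * u z) ∂μ) * Complex.I_sq

/-- The phase satisfies (1 - ∑ ∂_{w i}²) e = (1 + |T|²) e. Writing u = (1 + |T|²) g, two
integrations by parts move the operator onto g, and it commutes with the weight because T vanishes
along the `w i`. -/
theorem integral_phase_mul_oneSubLap (hu : RapidDecay B u) (he : ContDiff ℝ ∞ e)
    (he1 : ∀ z, ‖e z‖ ≤ 1) {w : Fin d → V} (hw : ∀ i, w i ∈ B) (T : V →L[ℝ] E d)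
    (hT : ∀ i, dirDeriv (w i) e = fun z => -Complex.I * (T z i : ℂ) * e z)
    (hT0 : ∀ i, T (w i) = 0) :
    ∫ z, e z * u z ∂μ = ∫ z, e z * (invBracket (T z) * oneSubLap w u z) ∂μ := by
  have hg := (tempGrowth_invBracket_comp (B := B) T).mul_rapidDecay hu
  set g : V → ℂ := fun z => invBracket (T z) * u z with hgdef
  have hgLap : oneSubLap w g = fun z => invBracket (T z) * oneSubLap w u z := by
    refine oneSubLap_mul_left w (contDiff_invBracket_comp T) hu.smooth fun i => ?_
    have := listDeriv_comp_clm [w i] (contDiff_invBracket (d := d)) T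
    simp only [listDeriv_cons, listDeriv_nil, List.map_cons, List.map_nil, hT0] at this
    rw [this]
    funext z
    simp [dirDeriv]
  let c : Fin d → V →L[ℝ] ℝ := fun i => (EuclideanSpace.proj i).comp T
  have hc : ∀ i z, c i z = T z i := fun i z => rfl
  have hcc : ∀ i, ∫ z, e z * ((c i z : ℂ) * ((c i z : ℂ) * g z)) ∂μ
      = - ∫ z, e z * dirDeriv (w i) (dirDeriv (w i) g) z ∂μ := by
    intro i
    have hTi : dirDeriv (w i) e = fun z => -Complex.I * (c i z : ℂ) * e z := hT i
    have h0 : dirDeriv (w i) (fun z => (c i z : ℂ) * g z)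
        = fun z => (c i z : ℂ) * dirDeriv (w i) g z := by
      have hcs := (tempGrowth_clm (B := B) (c i)).smooth
      have : dirDeriv (w i) (fun z => (c i z : ℂ)) = fun _ => 0 := by
        funext z
        have h := (Complex.ofRealCLM.comp (c i)).hasFDerivAt (x := z)
        refine (congrArg (fun A : V →L[ℝ] ℂ => A (w i)) h.fderiv).trans ?_
        simp [hc, hT0]
      rw [dirDeriv_mul hcs hg.smooth, this]
      simp
    rw [integral_phase_mul ((tempGrowth_clm (c i)).mul_rapidDecay hg) he he1 (hw i) (c i) hTi, h0,
      integral_phase_mul (hg.dirDeriv (hw i)) he he1 (hw i) (c i) hTi, ← mul_assoc]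
    simp
  have hug : ∀ z, e z * u z = e z * g z + ∑ i, e z * ((c i z : ℂ) * ((c i z : ℂ) * g z)) := by
    intro z
    have h1 : u z = (1 + ((‖T z‖ ^ 2 : ℝ) : ℂ)) * g z := by
      have : (1 + ((‖T z‖ ^ 2 : ℝ) : ℂ)) ≠ 0 := by
        have : (1 + ‖T z‖ ^ 2 : ℝ) ≠ 0 := by positivity
        exact_mod_cast this
      simp only [hgdef, invBracket]
      push_cast at this ⊢
      field_simp
    rw [h1, EuclideanSpace.real_norm_sq_eq]
    push_cast
    rw [add_mul, one_mul, mul_add, Finset.sum_mul, Finset.mul_sum]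
    congr 1
    refine Finset.sum_congr rfl fun i _ => ?_
    rw [hc]; ring
  have hi : ∀ i, RapidDecay B fun z => (c i z : ℂ) * ((c i z : ℂ) * g z) := fun i =>
    (tempGrowth_clm (c i)).mul_rapidDecay ((tempGrowth_clm (c i)).mul_rapidDecay hg)
  have hD : ∀ i, RapidDecay B (dirDeriv (w i) (dirDeriv (w i) g)) := fun i =>
    (hg.dirDeriv (hw i)).dirDeriv (hw i)
  have cont := he.continuous
  have hgLap' : ∀ z, invBracket (T z) * oneSubLap w u z = oneSubLap w g z := fun z =>
    (congrFun hgLap z).symm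
  simp only [hgLap']
  simp only [hug, oneSubLap, mul_sub, Finset.mul_sum]
  rw [MeasureTheory.integral_add (hg.integrable_mul cont he1)
      (MeasureTheory.integrable_finsetSum _ fun i _ => (hi i).integrable_mul cont he1),
    MeasureTheory.integral_finsetSum _ fun i _ => (hi i).integrable_mul cont he1,
    MeasureTheory.integral_sub (hg.integrable_mul cont he1)
      (MeasureTheory.integrable_finsetSum _ fun i _ => (hD i).integrable_mul cont he1),
    MeasureTheory.integral_finsetSum _ fun i _ => (hD i).integrable_mul cont he1]
  simp only [hcc, Finset.sum_neg_distrib, sub_eq_add_neg]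

/-- By `hT0` all weights are constant along all directions used, so the weights already produced
pass through each further operator. -/
theorem integral_phase_mul_iterLap (hu : RapidDecay B u) (he : ContDiff ℝ ∞ e)
    (he1 : ∀ z, ‖e z‖ ≤ 1) {w : J → Fin d → V} (hw : ∀ j i, w j i ∈ B) (T : J → V →L[ℝ] E d)
    (hT : ∀ j i, dirDeriv (w j i) e = fun z => -Complex.I * (T j z i : ℂ) * e z)
    (hT0 : ∀ j r i, T j (w r i) = 0) (l : List J) :
    ∫ z, e z * u z ∂μ = ∫ z, e z * (weightProd T l z * iterLap w l u z) ∂μ := by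
  induction l with
  | nil => simp [weightProd]
  | cons j l ih =>
    rw [ih, integral_phase_mul_oneSubLap ((hu.iterLap hw l).weightProd_mul T l) he he1 (hw j) (T j)
      (hT j) (hT0 j j), oneSubLap_mul_left (w j) (contDiff_weightProd T l)
      (contDiff_iterLap w l hu.smooth)
      fun i => dirDeriv_weightProd_eq_zero T l fun r => hT0 r j i]
    simp only [weightProd, List.map_cons, List.prod_cons, iterLap_cons, mul_assoc]

end IterLap

/-! ### Counting occurrences in lists of block indices. -/

section Lists

theorem length_eq_sum_countP {n d : ℕ} (T : List (Fin n × Fin d)) :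
    T.length = ∑ j, T.countP (fun p => p.1 = j) := by
  induction T with
  | nil => simp
  | cons p T ih => simp [List.countP_cons, Finset.sum_add_distrib, ih]

theorem length_le_of_countP_le {n d m : ℕ} {T : List (Fin n × Fin d)}
    (h : ∀ j, T.countP (fun p => p.1 = j) ≤ m) : T.length ≤ n * m := by
  rw [length_eq_sum_countP]
  simpa using Finset.sum_le_sum fun j (_ : j ∈ Finset.univ) => h j

/-- The list in which each element of `Fin n` is repeated `N` times. -/
def repList (n N : ℕ) : List (Fin n) := (List.finRange n).flatMap (List.replicate N)

theorem length_repList (n N : ℕ) : (repList n N).length = n * N := by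
  simp [repList, List.length_flatMap]

theorem count_repList {n : ℕ} (N : ℕ) (j : Fin n) : (repList n N).count j = N := by
  rw [repList, List.count_flatMap]
  simp only [Function.comp_def, List.count_replicate]
  rw [← List.ofFn_eq_map, List.sum_ofFn]
  simp

theorem prod_map_repList {n : ℕ} (N : ℕ) (f : Fin n → ℂ) :
    ((repList n N).map f).prod = ∏ j, f j ^ N := by
  rw [repList, List.map_flatMap, List.flatMap_def, List.prod_flatten, List.map_map]
  simp only [Function.comp_def, List.map_replicate, List.prod_replicate]
  rw [← List.ofFn_eq_map, List.prod_ofFn]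

end Lists

/-! ### Phase, directions and the transformed integrand. -/

section Directions

variable {n d : ℕ}

/-- The entries of the bidiagonal matrix of `(η^j) ↦ (η^j - η^{j+1})`. -/
def bidiag (j r : Fin n) : ℝ :=
  (if (r : ℕ) = j then 1 else 0) - (if (r : ℕ) = j + 1 then 1 else 0)

/-- The coordinate `y^j`. -/
def posMap (j : Fin n) : Tup n d × Tup n d →L[ℝ] E d :=
  (ContinuousLinearMap.proj j).comp (ContinuousLinearMap.fst ℝ _ _)

/-- The difference `η^j - η^{j+1}`. -/
def freqDiff (j : Fin n) : Tup n d × Tup n d →L[ℝ] E d :=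
  ∑ r, bidiag j r • (ContinuousLinearMap.proj r).comp (ContinuousLinearMap.snd ℝ _ _)

theorem posMap_apply (j : Fin n) (p : Tup n d × Tup n d) : posMap j p = p.1 j := rfl

theorem freqDiff_apply (j : Fin n) (p : Tup n d × Tup n d) :
    freqDiff j p = ∑ r, bidiag j r • p.2 r := by
  simp [freqDiff]

/-- The direction along which the partial sum `y^0 + ⋯ + y^j` varies, the others being fixed. -/
def posDir (j : Fin n) (i : Fin d) : Tup n d × Tup n d :=
  (fun r => bidiag j r • EuclideanSpace.single i 1, 0)

/-- The direction of the coordinate `η^j_i`. -/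
def freqDir (j : Fin n) (i : Fin d) : Tup n d × Tup n d :=
  (0, Pi.single j (EuclideanSpace.single i 1))

theorem freqDiff_posDir (j r : Fin n) (i : Fin d) : freqDiff j (posDir r i) = 0 := by
  simp [freqDiff_apply, posDir]

theorem posMap_freqDir (j r : Fin n) (i : Fin d) : posMap j (freqDir r i) = 0 := by
  simp [posMap_apply, freqDir]

theorem freqDiff_freqDir (j r : Fin n) (i : Fin d) :
    freqDiff j (freqDir r i) = bidiag j r • EuclideanSpace.single i (1 : ℝ) := by
  rw [freqDiff_apply, Finset.sum_eq_single r]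
  · simp [freqDir]
  · intro s _ hs
    simp [freqDir, Pi.single_eq_of_ne hs]
  · simp

/-- The phase `∑ j, y^j · η^j`. -/
def pairing (p : Tup n d × Tup n d) : ℝ := ∑ j, inner ℝ (p.1 j) (p.2 j)

/-- The oscillating factor `exp (-i ∑ j, y^j · η^j)`. -/
def oscFactor (p : Tup n d × Tup n d) : ℂ := Complex.exp (-(Complex.I * (pairing p : ℂ)))

theorem contDiff_pairing : ContDiff ℝ ∞ (pairing : Tup n d × Tup n d → ℝ) := by
  refine ContDiff.sum fun j _ => ContDiff.inner ℝ ?_ ?_ <;> fun_prop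

theorem contDiff_oscFactor : ContDiff ℝ ∞ (oscFactor : Tup n d × Tup n d → ℂ) :=
  ((contDiff_const.mul (Complex.ofRealCLM.contDiff.comp contDiff_pairing)).neg).cexp

theorem norm_oscFactor (p : Tup n d × Tup n d) : ‖oscFactor p‖ = 1 := by
  rw [oscFactor, Complex.norm_exp]
  simp

theorem fderiv_pairing (p v : Tup n d × Tup n d) :
    fderiv ℝ pairing p v = ∑ j, (inner ℝ (p.1 j) (v.2 j) + inner ℝ (v.1 j) (p.2 j)) := by
  have h1 : ∀ j : Fin n, HasFDerivAt (fun p : Tup n d × Tup n d => p.1 j)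
      ((ContinuousLinearMap.proj j).comp (ContinuousLinearMap.fst ℝ _ _)) p := fun j =>
    ((ContinuousLinearMap.proj j).comp (ContinuousLinearMap.fst ℝ (Tup n d) (Tup n d))).hasFDerivAt
  have h2 : ∀ j : Fin n, HasFDerivAt (fun p : Tup n d × Tup n d => p.2 j)
      ((ContinuousLinearMap.proj j).comp (ContinuousLinearMap.snd ℝ _ _)) p := fun j =>
    ((ContinuousLinearMap.proj j).comp (ContinuousLinearMap.snd ℝ (Tup n d) (Tup n d))).hasFDerivAt
  unfold pairing
  rw [fderiv_fun_sum fun j _ => ((h1 j).differentiableAt.inner ℝ (h2 j).differentiableAt),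
    sum_apply]
  refine Finset.sum_congr rfl fun j _ => ?_
  rw [fderiv_inner_apply ℝ (h1 j).differentiableAt (h2 j).differentiableAt, (h1 j).fderiv,
    (h2 j).fderiv]
  rfl

theorem dirDeriv_oscFactor (v : Tup n d × Tup n d) :
    dirDeriv v oscFactor =
      fun p => -Complex.I * ((fderiv ℝ pairing p v : ℝ) : ℂ) * oscFactor p := by
  funext p
  have h1 := (smooth_differentiable contDiff_pairing p).hasFDerivAt (f := pairing)
  have h2 := ((Complex.ofRealCLM.hasFDerivAt.comp p h1).const_mul Complex.I).neg.cexp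
  refine (congrArg (fun A : (Tup n d × Tup n d) →L[ℝ] ℂ => A v) h2.fderiv).trans ?_
  simp [oscFactor]
  ring

/-- Summation by parts in the phase: η^j - η^{j+1} is the variable dual to the j-th partial sum of
the y's. For the last j the term η^{j+1} is absent. -/
theorem dirDeriv_posDir_oscFactor (j : Fin n) (i : Fin d) :
    dirDeriv (posDir j i) oscFactor = fun p => -Complex.I * (freqDiff j p i : ℂ) * oscFactor p := by
  rw [dirDeriv_oscFactor]
  funext p
  rw [fderiv_pairing, freqDiff_apply]
  congr 3
  simp [posDir, inner_smul_left, EuclideanSpace.inner_single_left]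

theorem dirDeriv_freqDir_oscFactor (j : Fin n) (i : Fin d) :
    dirDeriv (freqDir j i) oscFactor = fun p => -Complex.I * (posMap j p i : ℂ) * oscFactor p := by
  rw [dirDeriv_oscFactor]
  funext p
  rw [fderiv_pairing, posMap_apply]
  congr 3
  rw [Finset.sum_eq_single j]
  · simp [freqDir, EuclideanSpace.inner_single_right]
  · intro s _ hs
    simp [freqDir, Pi.single_eq_of_ne hs]
  · simp

/-- The directions used in the integrations by parts. -/
def coordDirs (n d : ℕ) : Set (Tup n d × Tup n d) :=
  Set.range (fun p : Fin n × Fin d => posDir p.1 p.2) ∪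
    Set.range (fun p : Fin n × Fin d => freqDir p.1 p.2)

theorem posDir_mem (j : Fin n) (i : Fin d) : posDir j i ∈ coordDirs n d := .inl ⟨(j, i), rfl⟩

theorem freqDir_mem (j : Fin n) (i : Fin d) : freqDir j i ∈ coordDirs n d := .inr ⟨(j, i), rfl⟩

theorem finite_coordDirs (n d : ℕ) : (coordDirs n d).Finite :=
  (Set.finite_range _).union (Set.finite_range _)

/-- The operator produced by the integrations by parts, first in the positions, then in the
frequencies. -/
def oscTransform (N N' : ℕ) (u : Tup n d × Tup n d → ℂ) : Tup n d × Tup n d → ℂ := fun z =>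
  weightProd posMap (repList n N') z * iterLap freqDir (repList n N')
    (fun z => weightProd freqDiff (repList n N) z * iterLap posDir (repList n N) u z) z

instance isAddHaarMeasure_volume_tup :
    (MeasureTheory.volume : MeasureTheory.Measure (Tup n d × Tup n d)).IsAddHaarMeasure :=
  MeasureTheory.Measure.prod.instIsAddHaarMeasure MeasureTheory.volume MeasureTheory.volume

/-- Within each of the two rounds the new weights are constant along the directions in use. In the
second round the frequency weights of the first are not, so they stay under the operator and are
differentiated later. -/
theorem integral_oscFactor_mul (N N' : ℕ) {u : Tup n d × Tup n d → ℂ}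
    (hu : RapidDecay (coordDirs n d) u) :
    ∫ z, oscFactor z * u z = ∫ z, oscFactor z * oscTransform N N' u z := by
  rw [integral_phase_mul_iterLap hu contDiff_oscFactor (fun z => (norm_oscFactor z).le) posDir_mem
    freqDiff dirDeriv_posDir_oscFactor freqDiff_posDir (repList n N),
    integral_phase_mul_iterLap ((hu.iterLap posDir_mem _).weightProd_mul freqDiff _)
    contDiff_oscFactor
    (fun z => (norm_oscFactor z).le) freqDir_mem
    posMap dirDeriv_freqDir_oscFactor posMap_freqDir (repList n N')]
  rfl

theorem contDiff_oscTransform (N N' : ℕ) {u : Tup n d × Tup n d → ℂ} (hu : ContDiff ℝ ∞ u) :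
    ContDiff ℝ ∞ (oscTransform N N' u) :=
  (contDiff_weightProd _ _).mul
    (contDiff_iterLap _ _ ((contDiff_weightProd _ _).mul (contDiff_iterLap _ _ hu)))

theorem oscTransform_sub (N N' : ℕ) {u v : Tup n d × Tup n d → ℂ} (hu : ContDiff ℝ ∞ u)
    (hv : ContDiff ℝ ∞ v) (z : Tup n d × Tup n d) :
    oscTransform N N' (fun z => u z - v z) z = oscTransform N N' u z - oscTransform N N' v z := by
  have hw := contDiff_weightProd (freqDiff : Fin n → (Tup n d × Tup n d) →L[ℝ] E d) (repList n N)
  simp only [oscTransform, iterLap_sub _ _ hu hv, mul_sub]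
  rw [iterLap_sub _ _ (hw.mul (contDiff_iterLap _ _ hu)) (hw.mul (contDiff_iterLap _ _ hv)),
    mul_sub]

theorem weightProd_repList (T : Fin n → (Tup n d × Tup n d) →L[ℝ] E d) (N : ℕ)
    (z : Tup n d × Tup n d) :
    weightProd T (repList n N) z = ∏ j, invBracket (T j z) ^ N :=
  prod_map_repList N _

theorem bidiag_eq_zero {j r : Fin n} (h1 : (r : ℕ) ≠ j) (h2 : (r : ℕ) ≠ j + 1) :
    bidiag j r = 0 := by
  simp [bidiag, h1, h2]

theorem bidiag_mem (j r : Fin n) : bidiag j r = 0 ∨ bidiag j r = 1 ∨ bidiag j r = -1 := by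
  unfold bidiag
  split_ifs <;> simp

/-- The coordinate vectors of `ℝ^d` and their opposites. -/
def signedBasis (d : ℕ) : Set (E d) :=
  Set.range (fun i => EuclideanSpace.single i (1 : ℝ)) ∪
    Set.range (fun i => -EuclideanSpace.single i (1 : ℝ))

theorem finite_signedBasis (d : ℕ) : (signedBasis d).Finite :=
  (Set.finite_range _).union (Set.finite_range _)

/-- The variable η^r occurs only in the differences with index r and r - 1. This is the source of
the geometric growth in n. -/
theorem card_freqDiff_ne_zero_le (r : Fin n) (i : Fin d)
    [∀ j, Decidable (freqDiff j (freqDir r i) ≠ 0)] :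
    (Finset.univ.filter fun j : Fin n => freqDiff j (freqDir r i) ≠ 0).card ≤ 2 := by
  classical
  have hsub : (Finset.univ.filter fun j : Fin n => freqDiff j (freqDir r i) ≠ 0) ⊆
      (Finset.univ.filter fun j : Fin n => (r : ℕ) = j) ∪
        (Finset.univ.filter fun j : Fin n => (r : ℕ) = j + 1) := by
    intro j hj
    simp only [Finset.mem_filter, Finset.mem_univ, true_and, Finset.mem_union] at hj ⊢
    by_contra! h
    exact hj (by rw [freqDiff_freqDir, bidiag_eq_zero h.1 h.2, zero_smul])
  refine (Finset.card_le_card hsub).trans ((Finset.card_union_le _ _).trans ?_)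
  have h1 : (Finset.univ.filter fun j : Fin n => (r : ℕ) = j).card ≤ 1 :=
    Finset.card_le_one.2 fun a ha b hb => by
      simp only [Finset.mem_filter, Finset.mem_univ, true_and] at ha hb
      omega
  have h2 : (Finset.univ.filter fun j : Fin n => (r : ℕ) = j + 1).card ≤ 1 :=
    Finset.card_le_one.2 fun a ha b hb => by
      simp only [Finset.mem_filter, Finset.mem_univ, true_and] at ha hb
      omega
  omega

/-- Derivatives of the frequency weights, with constants growing geometrically in `n`. -/
theorem norm_listDeriv_weightProd_freqDiff_le (d N m : ℕ) :
    ∃ C : ℝ, 1 ≤ C ∧ ∀ (n : ℕ) (S : List (Fin n × Fin d)) (z : Tup n d × Tup n d),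
      (∀ j, S.countP (fun p => p.1 = j) ≤ m) →
      ‖listDeriv (S.map fun p => freqDir p.1 p.2) (weightProd freqDiff (repList n N)) z‖
        ≤ C ^ n * ‖weightProd freqDiff (repList n N) z‖ := by
  classical
  -- The j-th factor sees derivatives in η^j and η^{j+1} only, at most m of each. They act through ±
  -- coordinate vectors, a finite set not depending on n.
  obtain ⟨C, hC1, hC⟩ := norm_listDeriv_invBracket_pow_le_uniform (d := d) N (2 * m)
    (signedBasis d) (finite_signedBasis d)
  -- `C` for each factor, and 2 for each of the at most n m derivatives.
  refine ⟨2 ^ m * C, one_le_mul_of_one_le_of_one_le (one_le_pow₀ (by norm_num)) hC1,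
    fun n S z hS => ?_⟩
  have hfun : weightProd (freqDiff : Fin n → (Tup n d × Tup n d) →L[ℝ] E d) (repList n N)
      = fun z => ∏ j, invBracket (freqDiff j z) ^ N := funext fun z => weightProd_repList _ _ z
  have hcomp : ∀ (j : Fin n) (L : List (Tup n d × Tup n d)),
      listDeriv L (fun z => invBracket (freqDiff j z) ^ N) =
        fun z => listDeriv (L.map (freqDiff j)) (fun w => invBracket w ^ N) (freqDiff j z) :=
    fun j L => listDeriv_comp_clm L (contDiff_invBracket.pow N) (freqDiff j)
  have hsm : ∀ j : Fin n, ContDiff ℝ ∞ fun z : Tup n d × Tup n d => invBracket (freqDiff j z) ^ N :=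
    fun j => (contDiff_invBracket_comp (freqDiff j)).pow N
  have hzero : ∀ (j : Fin n) (v : Tup n d × Tup n d), ¬ freqDiff j v ≠ 0 →
      dirDeriv v (fun z => invBracket (freqDiff j z) ^ N) = fun _ => 0 := by
    intro j v hv
    rw [not_not] at hv
    have := hcomp j [v]
    simp only [listDeriv_cons, listDeriv_nil, List.map_cons, List.map_nil, hv] at this
    rw [this]
    funext z
    simp [dirDeriv]
  have hmain := norm_listDeriv_prod_le (S.map fun p => freqDir p.1 p.2) hsm
    (fun j v => freqDiff j v ≠ 0) 2 z (A := fun j => C * ‖invBracket (freqDiff j z)‖ ^ N) hzero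
    (by
      intro v hv
      obtain ⟨p, -, rfl⟩ := List.mem_map.1 hv
      exact card_freqDiff_ne_zero_le p.1 p.2)
    (by
      intro j L hL
      obtain ⟨S', hS', rfl⟩ := List.sublist_map_iff.1 hL
      by_cases h : ∃ p ∈ S', freqDiff j (freqDir p.1 p.2) = 0
      · obtain ⟨p, hp, hp0⟩ := h
        rw [listDeriv_eq_zero_of_mem (hsm j) ⟨_, List.mem_map.2 ⟨p, hp, rfl⟩,
          hzero j _ (not_not.2 hp0)⟩, norm_zero]
        positivity
      · push Not at h
        rw [hcomp]
        refine hC _ ?_ ?_ _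
        · have hb : ∀ p ∈ S', (p.1 : ℕ) = j ∨ (p.1 : ℕ) = j + 1 := by
            intro p hp
            by_contra! h'
            exact h p hp (by rw [freqDiff_freqDir, bidiag_eq_zero h'.1 h'.2, zero_smul])
          have hlen : S'.length ≤ S'.countP (fun p => (p.1 : ℕ) = j)
              + S'.countP (fun p => (p.1 : ℕ) = j + 1) := by
            clear hL hS' h
            induction S' with
            | nil => simp
            | cons p S' ih =>
              have h1 := ih fun q hq => hb q (List.mem_cons_of_mem _ hq)
              rw [List.countP_cons, List.countP_cons, List.length_cons]
              rcases hb p List.mem_cons_self with h2 | h2 <;> simp only [h2] <;> simp <;> omega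
          have hle : ∀ k : ℕ, S'.countP (fun p => (p.1 : ℕ) = k) ≤ m := by
            intro k
            -- The index j + 1 may equal n, where there is no block and nothing to count.
            by_cases hk : k < n
            · refine le_trans (le_of_eq ?_) (hS'.countP_le.trans (hS ⟨k, hk⟩))
              congr 1
              funext p
              simp [Fin.ext_iff]
            · rw [List.countP_eq_zero.2]
              · exact Nat.zero_le _
              · intro p _
                simp only [decide_eq_true_eq]
                have := p.1.isLt
                omega
          simp only [List.length_map]
          have := hle j
          have := hle (j + 1)
          omega
        · intro v hv
          simp only [List.map_map, List.mem_map, Function.comp_apply] at hv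
          obtain ⟨p, hp, rfl⟩ := hv
          have hp0 := h p hp
          rw [freqDiff_freqDir] at hp0 ⊢
          rcases bidiag_mem j p.1 with hb | hb | hb
          · simp [hb] at hp0
          · exact .inl ⟨p.2, by simp [hb]⟩
          · exact .inr ⟨p.2, by simp [hb]⟩)
  rw [hfun]
  refine hmain.trans ?_
  rw [Finset.prod_mul_distrib, Finset.prod_const, Finset.card_univ, Fintype.card_fin, norm_prod,
    mul_pow, ← pow_mul, List.length_map, mul_assoc]
  simp only [norm_pow]
  have hlen := length_le_of_countP_le hS
  have h2 : ((2 : ℕ) : ℝ) ^ S.length ≤ 2 ^ (m * n) := by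
    rw [mul_comm m n]
    exact pow_le_pow_right₀ (by norm_num) hlen
  gcongr

/-- The pointwise size of the transformed integrand. -/
theorem norm_oscTransform_le (d N N' : ℕ) :
    ∃ C : ℝ, 1 ≤ C ∧ ∀ (n : ℕ) (u : Tup n d × Tup n d → ℂ) (z : Tup n d × Tup n d) (A : ℝ),
      ContDiff ℝ ∞ u →
      (∀ T S : List (Fin n × Fin d), (∀ j, T.countP (fun p => p.1 = j) ≤ 2 * N) →
        (∀ j, S.countP (fun p => p.1 = j) ≤ 2 * N') →
        ‖listDeriv (T.map (fun p => posDir p.1 p.2) ++ S.map fun p => freqDir p.1 p.2) u z‖ ≤ A) →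
      ‖oscTransform N N' u z‖ ≤ C ^ n * (‖weightProd posMap (repList n N') z‖ *
        ‖weightProd freqDiff (repList n N) z‖ * A) := by
  obtain ⟨C, hC1, hC⟩ := norm_listDeriv_weightProd_freqDiff_le d N (2 * N')
  have hd : (1 : ℝ) ≤ (d : ℝ) + 1 := by linarith [Nat.cast_nonneg (α := ℝ) d]
  -- Cost per block: an operator 1 - Δ has d + 1 terms, applied N' times in frequency and N times in
  -- position; the Leibniz rule costs 2 for each of 2N' derivatives; `C` bounds those of the
  -- weights.
  refine ⟨((d : ℝ) + 1) ^ N' * (2 ^ (2 * N') * (C * ((d : ℝ) + 1) ^ N)), ?_,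
    fun n u z A hu hA => ?_⟩
  · refine one_le_mul_of_one_le_of_one_le (one_le_pow₀ hd) (one_le_mul_of_one_le_of_one_le
      (one_le_pow₀ (by norm_num)) (one_le_mul_of_one_le_of_one_le hC1 (one_le_pow₀ hd)))
  have hA0 : 0 ≤ A := (norm_nonneg _).trans (hA [] [] (by simp) (by simp))
  set G : Tup n d × Tup n d → ℂ := weightProd freqDiff (repList n N) with hG
  have hGs : ContDiff ℝ ∞ G := contDiff_weightProd _ _
  have hRs : ContDiff ℝ ∞ (iterLap posDir (repList n N) u) := contDiff_iterLap _ _ hu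
  have hR : ∀ S : List (Fin n × Fin d), (∀ j, S.countP (fun p => p.1 = j) ≤ 2 * N') →
      ‖listDeriv (S.map fun p => freqDir p.1 p.2) (iterLap posDir (repList n N) u) z‖
        ≤ ((d : ℝ) + 1) ^ (n * N) * A := by
    intro S hS
    have := norm_listDeriv_iterLap_le posDir (repList n N) hu
      (S.map fun p => freqDir p.1 p.2) z (A := A) fun T hT =>
        hA T S (fun j => by simpa only [count_repList] using hT j) hS
    rwa [length_repList] at this
  have h1 := norm_listDeriv_iterLap_le freqDir (repList n N') (hGs.mul hRs) [] z
    (A := 2 ^ (n * (2 * N')) * ((C ^ n * ‖G z‖) * (((d : ℝ) + 1) ^ (n * N) * A))) fun S hS => by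
      simp only [count_repList] at hS
      rw [List.append_nil]
      refine (norm_listDeriv_mul_le _ hGs hRs z (A := C ^ n * ‖G z‖)
        (B := ((d : ℝ) + 1) ^ (n * N) * A) ?_ ?_).trans ?_
      · intro L hL
        obtain ⟨S', hS', rfl⟩ := List.sublist_map_iff.1 hL
        exact hC n S' z fun j => hS'.countP_le.trans (hS j)
      · intro L hL
        obtain ⟨S', hS', rfl⟩ := List.sublist_map_iff.1 hL
        exact hR S' fun j => hS'.countP_le.trans (hS j)
      · refine mul_le_mul_of_nonneg_right ?_ (by positivity)
        rw [List.length_map]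
        exact pow_le_pow_right₀ (by norm_num) (length_le_of_countP_le hS)
  rw [listDeriv_nil, length_repList] at h1
  rw [oscTransform, norm_mul]
  refine (mul_le_mul_of_nonneg_left h1 (norm_nonneg _)).trans (le_of_eq ?_)
  simp only [mul_pow, ← pow_mul]
  rw [mul_comm N' n, mul_comm N n, mul_comm (2 * N') n]
  ring

end Directions

/-! ### Translation between lists of directions and multi-indices. -/

section MultiIndices

variable {V F : Type*} [NormedAddCommGroup V] [NormedSpace ℝ V]
  [NormedAddCommGroup F] [NormedSpace ℝ F]

/-- The reversal reflects that `foldr` applies the last operator first, while `listDeriv` applies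
the head first. -/
theorem foldr_eq_listDeriv {ι : Type*} (op : ι → (V → F) → V → F) (L : ι → List V)
    (h : ∀ i g, op i g = listDeriv (L i) g) (l : List ι) (f : V → F) :
    l.foldr op f = listDeriv (l.reverse.flatMap L) f := by
  induction l with
  | nil => rfl
  | cons i l ih =>
    rw [List.foldr_cons, ih, h, ← listDeriv_append, List.reverse_cons, List.flatMap_append]
    simp

theorem iterate_dirDeriv (v : V) (m : ℕ) (f : V → F) :
    (dirDeriv v)^[m] f = listDeriv (List.replicate m v) f := by
  induction m generalizing f with
  | zero => rfl
  | succ m ih => rw [Function.iterate_succ_apply, ih, List.replicate_succ, listDeriv_cons]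

/-- The list in which `i` occurs `α i` times. -/
def multiIdx {d : ℕ} (α : Fin d → ℕ) : List (Fin d) :=
  (List.finRange d).reverse.flatMap fun i => List.replicate (α i) i

/-- The list in which `(j, i)` occurs `α j i` times. -/
def blockIdx {k d : ℕ} (α : Fin k → Fin d → ℕ) : List (Fin k × Fin d) :=
  (List.finRange k).reverse.flatMap fun j => (multiIdx (α j)).map (Prod.mk j)

theorem count_flatMap_finRange_reverse {X : Type*} [BEq X] {k : ℕ} (f : Fin k → List X)
    (x : X) : ((List.finRange k).reverse.flatMap f).count x = ∑ j, (f j).count x := by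
  rw [List.count_flatMap, List.map_reverse, List.sum_reverse, ← List.ofFn_eq_map, List.sum_ofFn]
  rfl

theorem count_multiIdx {d : ℕ} (α : Fin d → ℕ) (i : Fin d) : (multiIdx α).count i = α i := by
  rw [multiIdx, count_flatMap_finRange_reverse]
  simp [List.count_replicate]

theorem count_blockIdx {k d : ℕ} (α : Fin k → Fin d → ℕ) (j : Fin k) (i : Fin d) :
    (blockIdx α).count (j, i) = α j i := by
  rw [blockIdx, count_flatMap_finRange_reverse, Finset.sum_eq_single j]
  · rw [List.count_map_of_injective _ _ (Prod.mk_right_injective j), count_multiIdx]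
  · intro r _ hr
    refine List.count_eq_zero.2 fun h => hr ?_
    obtain ⟨s, -, hs⟩ := List.mem_map.1 h
    exact (Prod.ext_iff.1 hs).1
  · simp

theorem perm_blockIdx_count {k d : ℕ} (T : List (Fin k × Fin d)) :
    (blockIdx fun j i => T.count (j, i)).Perm T :=
  List.perm_iff_count.2 fun p => count_blockIdx _ p.1 p.2

theorem order_count {k d : ℕ} (T : List (Fin k × Fin d)) (j : Fin k) :
    order (fun i => T.count (j, i)) = T.countP (fun p => p.1 = j) := by
  unfold order
  induction T with
  | nil => simp
  | cons p T ih =>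
    simp only [List.count_cons, List.countP_cons, Finset.sum_add_distrib, ih]
    congr 1
    obtain ⟨r, s⟩ := p
    by_cases h : r = j <;> simp [h]

theorem multiDeriv_eq_listDeriv {d : ℕ} (e : Fin d → V) (α : Fin d → ℕ) (f : V → F) :
    multiDeriv e α f = listDeriv ((multiIdx α).map e) f := by
  rw [multiDeriv, multiIdx, foldr_eq_listDeriv _ (fun i => List.replicate (α i) (e i))
    fun i g => iterate_dirDeriv _ _ g]
  simp [List.map_flatMap, List.map_replicate]

theorem multiDeriv_single {d : ℕ} (e : Fin d → V) (i : Fin d) {f : V → F} (hf : ContDiff ℝ ∞ f) :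
    multiDeriv e (Pi.single i 1) f = dirDeriv (e i) f := by
  have hp : (multiIdx (Pi.single i 1)).Perm [i] := List.perm_iff_count.2 fun r => by
    rw [count_multiIdx, List.count_singleton]
    by_cases h : i = r
    · subst h; simp
    · simp [h, Ne.symm h]
  rw [multiDeriv_eq_listDeriv, listDeriv_perm (hp.map e) hf]
  rfl

theorem foldr_multiDeriv {k d : ℕ} (e : Fin k → Fin d → V) (α : Fin k → Fin d → ℕ) (f : V → F) :
    (List.finRange k).foldr (fun j h => multiDeriv (e j) (α j) h) f =
      listDeriv ((blockIdx α).map fun p => e p.1 p.2) f := by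
  rw [foldr_eq_listDeriv _ (fun j => (multiIdx (α j)).map (e j))
    fun j g => multiDeriv_eq_listDeriv _ _ g]
  simp [blockIdx, List.map_flatMap, Function.comp_def]

/-- The coordinate direction `x^j_i`. -/
def basisPos {k d : ℕ} (j : Fin k) (i : Fin d) : Tup k d × Tup k d :=
  (Pi.single j (EuclideanSpace.single i 1), 0)

theorem norm_symbolDeriv {k d : ℕ} (α β : Fin k → Fin d → ℕ) {a : Tup k d × Tup k d → ℂ}
    (ha : ContDiff ℝ ∞ a) (z : Tup k d × Tup k d) :
    ‖symbolDeriv α β a z‖ = ‖listDeriv ((blockIdx β).map (fun p => basisPos p.1 p.2) ++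
      (blockIdx α).map fun p => freqDir p.1 p.2) a z‖ := by
  rw [symbolDeriv]
  change ‖(List.finRange k).foldr (fun j h => multiDeriv (freqDir j) (α j) h)
    (fun z => (-Complex.I) ^ (∑ j, order (β j)) * (List.finRange k).foldr
      (fun j h => multiDeriv (basisPos j) (β j) h) a z) z‖ = _
  rw [foldr_multiDeriv, foldr_multiDeriv, listDeriv_const_mul _ (contDiff_listDeriv _ ha),
    listDeriv_append, norm_mul]
  simp

/-- A list is determined up to permutation by its counts, and the factors -i in D have modulus one.
-/
theorem norm_listDeriv_eq_norm_symbolDeriv {k d : ℕ} (T S : List (Fin k × Fin d))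
    {a : Tup k d × Tup k d → ℂ} (ha : ContDiff ℝ ∞ a) (z : Tup k d × Tup k d) :
    ‖listDeriv (T.map (fun p => basisPos p.1 p.2) ++ S.map fun p => freqDir p.1 p.2) a z‖ =
      ‖symbolDeriv (fun j i => S.count (j, i)) (fun j i => T.count (j, i)) a z‖ := by
  rw [norm_symbolDeriv _ _ ha, listDeriv_perm (((perm_blockIdx_count T).map _).append
    ((perm_blockIdx_count S).map _)) ha]

end MultiIndices

/-! ### Derivatives of the shifted amplitude. -/

section Amplitude

variable {n d : ℕ}

/-- The linear part of the argument of the amplitude. -/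
def amplitudeMap (n d : ℕ) (θ : ℝ) :
    (Tup n d × Tup n d) →L[ℝ] Tup (n + 1) d × Tup (n + 1) d :=
  (ContinuousLinearMap.pi fun j => ∑ i : Fin n with i.castSucc < j, posMap i).prod
    (ContinuousLinearMap.pi fun j =>
      Fin.snoc (α := fun _ => (Tup n d × Tup n d) →L[ℝ] E d)
        (fun i => θ • (ContinuousLinearMap.proj i).comp (ContinuousLinearMap.snd ℝ _ _)) 0 j)

theorem shiftedAmplitude_eq (a : Tup (n + 1) d × Tup (n + 1) d → ℂ) (θ : ℝ) (x ξ : E d) :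
    shiftedAmplitude a θ x ξ = fun p => a ((fun _ => x, fun _ => ξ) + amplitudeMap n d θ p) := by
  funext p
  rw [shiftedAmplitude]
  congr 1
  refine Prod.ext (funext fun j => ?_) (funext fun j => ?_)
  · simp [amplitudeMap, posMap_apply]
  · refine Fin.lastCases ?_ (fun i => ?_) j <;> simp [amplitudeMap]

theorem sum_ite_castSucc_lt (r : Fin (n + 1)) (k : ℕ) :
    (∑ s : Fin n with s.castSucc < r, if (s : ℕ) = k then (1 : ℝ) else 0) =
      if k < r then 1 else 0 := by
  split_ifs with h
  · have hk : k < n := by omega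
    rw [Finset.sum_eq_single ⟨k, hk⟩]
    · simp
    · intro s _ hs
      rw [if_neg fun h' => hs (Fin.ext h')]
    · intro h'
      simp [Fin.lt_def] at h'
      omega
  · refine Finset.sum_eq_zero fun s hs => if_neg ?_
    simp only [Finset.mem_filter, Finset.mem_univ, true_and, Fin.lt_def, Fin.val_castSucc] at hs
    omega

/-- The increments at y^j and y^{j+1} cancel in all later partial sums, so a single position block
moves. Hence the derivatives per block stay bounded independently of n. -/
theorem amplitudeMap_posDir (θ : ℝ) (j : Fin n) (i : Fin d) :
    amplitudeMap n d θ (posDir j i) = basisPos j.succ i := by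
  refine Prod.ext (funext fun r => ?_) (funext fun r => ?_)
  · have h : (∑ s : Fin n with s.castSucc < r, bidiag j s) = if r = j.succ then 1 else 0 := by
      simp only [bidiag, Finset.sum_sub_distrib, sum_ite_castSucc_lt, Fin.ext_iff, Fin.val_succ]
      split_ifs <;> first | omega | norm_num
    simp only [amplitudeMap, ContinuousLinearMap.prod_apply, ContinuousLinearMap.pi_apply,
      sum_apply, posMap_apply, posDir, basisPos, ← Finset.sum_smul, h, Pi.single_apply]
    split_ifs <;> simp
  · refine Fin.lastCases ?_ (fun i => ?_) r <;> simp [amplitudeMap, posDir, basisPos]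

theorem amplitudeMap_freqDir (θ : ℝ) (j : Fin n) (i : Fin d) :
    amplitudeMap n d θ (freqDir j i) = θ • freqDir j.castSucc i := by
  refine Prod.ext (funext fun r => ?_) (funext fun r => ?_)
  · simp [amplitudeMap, posMap_apply, freqDir]
  · refine Fin.lastCases ?_ (fun s => ?_) r
    · simp [amplitudeMap, freqDir, (Fin.castSucc_lt_last j).ne']
    · by_cases h : s = j
      · subst h; simp [amplitudeMap, freqDir]
      · simp [amplitudeMap, freqDir, h]

theorem contDiff_shiftedAmplitude {a : Tup (n + 1) d × Tup (n + 1) d → ℂ} (ha : ContDiff ℝ ∞ a)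
    (θ : ℝ) (x ξ : E d) : ContDiff ℝ ∞ (shiftedAmplitude a θ x ξ) := by
  rw [shiftedAmplitude_eq]
  exact contDiff_comp_affine ha _ _

/-- The indices of the blocks of `a` hit by derivatives in the positions. -/
def posIdx (T : List (Fin n × Fin d)) : List (Fin (n + 1) × Fin d) :=
  T.map fun p => (p.1.succ, p.2)

/-- The indices of the blocks of `a` hit by derivatives in the frequencies. -/
def freqIdx (T : List (Fin n × Fin d)) : List (Fin (n + 1) × Fin d) :=
  T.map fun p => (p.1.castSucc, p.2)

theorem countP_posIdx_le {T : List (Fin n × Fin d)} {m : ℕ}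
    (hT : ∀ j, T.countP (fun p => p.1 = j) ≤ m) (j : Fin (n + 1)) :
    (posIdx T).countP (fun p => p.1 = j) ≤ m := by
  rw [posIdx, List.countP_map]
  refine Fin.cases ?_ (fun r => ?_) j
  · rw [List.countP_eq_zero.2 (by simp)]
    exact Nat.zero_le _
  · simpa [Function.comp_def] using hT r

theorem countP_freqIdx_le {T : List (Fin n × Fin d)} {m : ℕ}
    (hT : ∀ j, T.countP (fun p => p.1 = j) ≤ m) (j : Fin (n + 1)) :
    (freqIdx T).countP (fun p => p.1 = j) ≤ m := by
  rw [freqIdx, List.countP_map]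
  refine Fin.lastCases ?_ (fun r => ?_) j
  · rw [List.countP_eq_zero.2 (by simp [(Fin.castSucc_lt_last _).ne])]
    exact Nat.zero_le _
  · simpa [Function.comp_def] using hT r

/-- Chain rule: position directions go to coordinate directions of `a`, and each frequency
derivative brings a factor θ, of modulus at most one. -/
theorem norm_listDeriv_shiftedAmplitude_le {a : Tup (n + 1) d × Tup (n + 1) d → ℂ}
    (ha : ContDiff ℝ ∞ a) {θ : ℝ} (hθ : |θ| ≤ 1) (x ξ : E d) (T S : List (Fin n × Fin d))
    (p : Tup n d × Tup n d) :
    ‖listDeriv (T.map (fun p => posDir p.1 p.2) ++ S.map fun p => freqDir p.1 p.2)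
        (shiftedAmplitude a θ x ξ) p‖ ≤
      ‖symbolDeriv (fun j i => (freqIdx S).count (j, i)) (fun j i => (posIdx T).count (j, i)) a
        ((fun _ => x, fun _ => ξ) + amplitudeMap n d θ p)‖ := by
  rw [shiftedAmplitude_eq, listDeriv_comp_affine _ ha, List.map_append, List.map_map, List.map_map,
    ← norm_listDeriv_eq_norm_symbolDeriv _ _ ha, listDeriv_append, listDeriv_append]
  simp only [posIdx, freqIdx, List.map_map, Function.comp_def, amplitudeMap_posDir,
    amplitudeMap_freqDir]
  exact norm_listDeriv_map_smul_le (fun p : Fin n × Fin d => freqDir p.1.castSucc p.2) (fun _ => θ)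
    (fun _ => hθ) S (contDiff_listDeriv _ ha) _

theorem exists_perm_of_forall_mem_coordDirs {S : List (Tup n d × Tup n d)}
    (hS : ∀ v ∈ S, v ∈ coordDirs n d) : ∃ T U : List (Fin n × Fin d),
      S.Perm (T.map (fun p => posDir p.1 p.2) ++ U.map fun p => freqDir p.1 p.2) := by
  induction S with
  | nil => exact ⟨[], [], by simp⟩
  | cons v S ih =>
    obtain ⟨hv, hS⟩ := List.forall_mem_cons.1 hS
    obtain ⟨T, U, h⟩ := ih hS
    rcases hv with ⟨p, rfl⟩ | ⟨p, rfl⟩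
    · exact ⟨p :: T, U, by simpa using h⟩
    · exact ⟨T, p :: U, (h.cons _).trans (by simpa using List.perm_middle.symm)⟩

end Amplitude

/-! ### Positivity, Lipschitz continuity and Peetre's inequality for ⟨ξ⟩. -/

section Bracket

variable {d : ℕ} {ψ : E d → ℝ}

/-- Take real parts in the Lévy–Khintchine formula: the drift disappears and the integrand becomes 1
- cos(ξ · y) ≥ 0. -/
theorem IsContNegDef.nonneg (h : IsContNegDef fun ξ => (ψ ξ : ℂ)) (ξ : E d) : 0 ≤ ψ ξ := by
  obtain ⟨c, b, Q, ν, hc, hQ, -, hψ⟩ := h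
  have h1 := congrArg Complex.re (hψ ξ)
  simp only [Complex.add_re, Complex.ofReal_re] at h1
  have h2 : 0 ≤ ξ.ofLp ⬝ᵥ Q.mulVec ξ.ofLp := by simpa using hQ.dotProduct_mulVec_nonneg ξ.ofLp
  have h3 : (Complex.I * ((inner ℝ b ξ : ℝ) : ℂ)).re = 0 := by simp
  rw [h1, h3]
  have h4 : 0 ≤ (∫ y in {0}ᶜ, (1 - Complex.exp (Complex.I * ((inner ℝ ξ y : ℝ) : ℂ))
      + Complex.I * ((inner ℝ ξ y / (1 + ‖y‖ ^ 2) : ℝ) : ℂ)) ∂ν).re := by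
    by_cases hi : MeasureTheory.IntegrableOn (fun y => (1 - Complex.exp (Complex.I *
        ((inner ℝ ξ y : ℝ) : ℂ)) + Complex.I * ((inner ℝ ξ y / (1 + ‖y‖ ^ 2) : ℝ) : ℂ))) {0}ᶜ ν
    · have := integral_re hi
      simp only [RCLike.re_eq_complex_re] at this
      rw [← this]
      refine MeasureTheory.integral_nonneg fun y => ?_
      simp only [Pi.zero_apply, Complex.add_re, Complex.sub_re, Complex.one_re]
      rw [mul_comm Complex.I ((inner ℝ ξ y : ℝ) : ℂ), Complex.exp_ofReal_mul_I_re]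
      simp only [Complex.re_mul_ofReal, Complex.I_re, zero_mul, add_zero]
      linarith [Real.cos_le_one (inner ℝ ξ y)]
    -- The integral of a non-integrable function is 0 by convention, so integrability need not be
    -- proved.
    · rw [MeasureTheory.integral_undef hi]; simp
  positivity

theorem IsAdmissible.one_le_bracket (hψ : IsAdmissible ψ) (ξ : E d) : 1 ≤ bracket ψ ξ :=
  Real.one_le_sqrt.2 (by linarith [hψ.negDef.nonneg ξ])

/-- The hypothesis with |α| = 1 reads 2⟨ξ⟩ |∂_i⟨ξ⟩| ≤ K_i ⟨ξ⟩; cancelling ⟨ξ⟩ bounds the gradient,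
and the mean value inequality concludes. -/
theorem IsAdmissible.exists_lipschitz (hψ : IsAdmissible ψ) :
    ∃ L : ℝ, 0 ≤ L ∧ ∀ ξ h : E d, bracket ψ (ξ + h) ≤ bracket ψ ξ + L * ‖h‖ := by
  have hpos : ∀ ξ, 0 < bracket ψ ξ := fun ξ => zero_lt_one.trans_le (hψ.one_le_bracket ξ)
  have hsq : (fun ξ => bracket ψ ξ ^ 2) = fun ξ => 1 + ψ ξ := funext fun ξ =>
    Real.sq_sqrt (by linarith [hψ.negDef.nonneg ξ])
  have hsqs : ContDiff ℝ ∞ fun ξ => bracket ψ ξ ^ 2 := by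
    rw [hsq]; exact contDiff_const.add hψ.smooth
  have hb : Differentiable ℝ (bracket ψ) := fun ξ =>
    ((differentiableAt_const 1).add (smooth_differentiable hψ.smooth ξ)).sqrt
      (show (1 : ℝ) + ψ ξ ≠ 0 from ne_of_gt (by linarith [hψ.negDef.nonneg ξ]))
  choose K hK using fun i : Fin d => hψ.bound (Pi.single i 1)
  have hd : ∀ ξ i, |fderiv ℝ (bracket ψ) ξ (EuclideanSpace.single i 1)| ≤ K i := by
    intro ξ i
    have h := hK i ξ
    rw [multiDeriv_single _ i hsqs] at h
    have ho : order (Pi.single i 1 : Fin d → ℕ) = 1 := by simp [order]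
    rw [ho, dirDeriv, fderiv_fun_pow 2 (hb ξ)] at h
    norm_num [rho] at h
    rw [abs_of_pos (hpos ξ)] at h
    have h0 := hpos ξ
    have h' : (2 * |fderiv ℝ (bracket ψ) ξ (EuclideanSpace.single i 1)|) * bracket ψ ξ
        ≤ K i * bracket ψ ξ := by linarith
    have := le_of_mul_le_mul_right h' h0
    linarith [abs_nonneg (fderiv ℝ (bracket ψ) ξ (EuclideanSpace.single i 1))]
  have hK0 : ∀ i, 0 ≤ K i := fun i => (abs_nonneg _).trans (hd 0 i)
  have hn : ∀ ξ, ‖fderiv ℝ (bracket ψ) ξ‖ ≤ ∑ i, K i := by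
    intro ξ
    refine ContinuousLinearMap.opNorm_le_bound _ (Finset.sum_nonneg fun i _ => hK0 i) fun v => ?_
    have hv : v = ∑ i, v i • EuclideanSpace.single i (1 : ℝ) := by
      ext r
      simp [Finset.sum_apply, Pi.single_apply]
    have h1 : fderiv ℝ (bracket ψ) ξ v =
        ∑ i, v i * fderiv ℝ (bracket ψ) ξ (EuclideanSpace.single i 1) := by
      conv_lhs => rw [hv]
      simp
    rw [h1, Finset.sum_mul]
    refine (norm_sum_le _ _).trans (Finset.sum_le_sum fun i _ => ?_)
    rw [norm_mul, mul_comm]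
    exact mul_le_mul (hd ξ i) (PiLp.norm_apply_le v i) (norm_nonneg _) (hK0 i)
  refine ⟨∑ i, K i, Finset.sum_nonneg fun i _ => hK0 i, fun ξ h => ?_⟩
  have := Convex.norm_image_sub_le_of_norm_fderiv_le (𝕜 := ℝ) (fun z _ => hb z) (fun z _ => hn z)
    convex_univ (Set.mem_univ ξ) (Set.mem_univ (ξ + h))
  rw [add_sub_cancel_left, Real.norm_eq_abs] at this
  linarith [(abs_le.1 this).2]

/-- Peetre's inequality. -/
theorem bracket_rpow_le (h1 : ∀ ξ, 1 ≤ bracket ψ ξ) {L : ℝ} (hL : 0 ≤ L)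
    (hlip : ∀ ξ h : E d, bracket ψ (ξ + h) ≤ bracket ψ ξ + L * ‖h‖) (ξ h : E d) (s : ℝ) :
    bracket ψ (ξ + h) ^ s ≤ bracket ψ ξ ^ s * (1 + L * ‖h‖) ^ |s| := by
  have key : ∀ ξ h : E d, bracket ψ (ξ + h) ≤ bracket ψ ξ * (1 + L * ‖h‖) := by
    intro ξ h
    have h2 : 0 ≤ L * ‖h‖ := by positivity
    nlinarith [hlip ξ h, h1 ξ]
  have p1 : 0 < bracket ψ ξ := zero_lt_one.trans_le (h1 ξ)
  have p2 : 0 < bracket ψ (ξ + h) := zero_lt_one.trans_le (h1 _)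
  have p3 : 0 < 1 + L * ‖h‖ := by positivity
  rcases le_or_gt 0 s with hs | hs
  · rw [abs_of_nonneg hs, ← Real.mul_rpow p1.le p3.le]
    exact Real.rpow_le_rpow p2.le (key ξ h) hs
  · rw [abs_of_neg hs, Real.rpow_neg p3.le, ← div_eq_mul_inv,
      le_div_iff₀ (Real.rpow_pos_of_pos p3 _),
      ← Real.mul_rpow p2.le p3.le]
    -- For a negative exponent the comparison is needed in the other direction, from ξ + h back to
    -- ξ.
    refine Real.rpow_le_rpow_of_nonpos p1 ?_ hs.le
    simpa using key (ξ + h) (-h)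

end Bracket

/-! ### Symbol estimates along the shifted amplitude. -/

section SymbolBounds

variable {n d : ℕ} {ψ : E d → ℝ}

theorem one_add_sum_le_prod {ι : Type*} (s : Finset ι) {f : ι → ℝ} (hf : ∀ i, 0 ≤ f i) :
    1 + ∑ i ∈ s, f i ≤ ∏ i ∈ s, (1 + f i) := by
  classical
  induction s using Finset.induction_on with
  | empty => simp
  | insert i s hi ih =>
    rw [Finset.sum_insert hi, Finset.prod_insert hi]
    have h1 := hf i
    have h2 : 0 ≤ ∑ i ∈ s, f i := Finset.sum_nonneg fun i _ => hf i
    nlinarith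

theorem sum_ite_le (r j : Fin n) :
    (∑ i : Fin n with j ≤ i, if (r : ℕ) = i + 1 then (1 : ℝ) else 0) =
      if (j : ℕ) + 1 ≤ r then 1 else 0 := by
  split_ifs with h
  · rw [Finset.sum_eq_single ⟨r - 1, by omega⟩]
    · rw [if_pos]
      simp only
      omega
    · intro s _ hs
      rw [if_neg fun h' => hs (Fin.ext (by simp only; omega))]
    · refine fun h' => absurd (Finset.mem_filter.2 ⟨Finset.mem_univ _, ?_⟩) h'
      change (j : ℕ) ≤ r - 1
      omega
  · refine Finset.sum_eq_zero fun s hs => if_neg ?_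
    simp only [Finset.mem_filter, Finset.mem_univ, true_and, Fin.le_def] at hs
    omega

/-- Telescoping; it closes up because the last difference is the last η itself. -/
theorem snd_eq_sum_freqDiff (p : Tup n d × Tup n d) (j : Fin n) :
    p.2 j = ∑ i : Fin n with j ≤ i, freqDiff i p := by
  have h : ∀ r, (∑ i : Fin n with j ≤ i, bidiag i r) = if r = j then 1 else 0 := by
    intro r
    simp only [bidiag, Finset.sum_sub_distrib, sum_ite_le, ← Fin.ext_iff]
    rw [Finset.sum_ite_eq]
    simp only [Finset.mem_filter, Finset.mem_univ, true_and, Fin.le_def, Fin.ext_iff]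
    split_ifs <;> first | omega | norm_num
  simp only [freqDiff_apply]
  rw [Finset.sum_comm]
  simp [← Finset.sum_smul, h]

theorem norm_snd_le_sum_freqDiff (p : Tup n d × Tup n d) (j : Fin n) :
    ‖p.2 j‖ ≤ ∑ i, ‖freqDiff i p‖ := by
  rw [snd_eq_sum_freqDiff]
  exact (norm_sum_le _ _).trans (Finset.sum_le_sum_of_subset_of_nonneg (Finset.filter_subset _ _)
    fun _ _ _ => norm_nonneg _)

/-- Peetre bounds each of the first n factors by a power |m_j| of the same product P = ∏ (1 + L|η^i
- η^{i+1}|), so the exponents add up to ∑ |m_j|. The last block is evaluated at ξ and needs no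
shift, which is why m_k does not enter that sum. -/
theorem prod_bracket_rpow_le (h1 : ∀ ξ, 1 ≤ bracket ψ ξ) {L : ℝ} (hL : 0 ≤ L)
    (hlip : ∀ ξ h : E d, bracket ψ (ξ + h) ≤ bracket ψ ξ + L * ‖h‖) {θ : ℝ} (hθ : |θ| ≤ 1)
    (m : Fin (n + 1) → ℝ) (x ξ : E d) (p : Tup n d × Tup n d) :
    ∏ j, bracket ψ (((fun _ => x, fun _ => ξ) + amplitudeMap n d θ p).2 j) ^ m j ≤
      bracket ψ ξ ^ (∑ j, m j) *
        ∏ i, (1 + L * ‖freqDiff i p‖) ^ (∑ j : Fin n, |m j.castSucc|) := by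
  have p1 : 0 < bracket ψ ξ := zero_lt_one.trans_le (h1 ξ)
  set P : ℝ := ∏ i, (1 + L * ‖freqDiff i p‖) with hP
  have hP1 : 1 ≤ P := by
    have := one_add_sum_le_prod Finset.univ (f := fun i => L * ‖freqDiff i p‖)
      fun i => by positivity
    have h0 : 0 ≤ ∑ i, L * ‖freqDiff i p‖ := Finset.sum_nonneg fun i _ => by positivity
    linarith
  have hj : ∀ j : Fin n, bracket ψ (((fun _ => x, fun _ => ξ) + amplitudeMap n d θ p).2 j.castSucc)
      ^ m j.castSucc ≤ bracket ψ ξ ^ m j.castSucc * P ^ |m j.castSucc| := by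
    intro j
    have e : ((fun _ => x, fun _ => ξ) + amplitudeMap n d θ p).2 j.castSucc = ξ + θ • p.2 j := by
      simp [amplitudeMap]
    rw [e]
    refine (bracket_rpow_le h1 hL hlip ξ _ _).trans ?_
    refine mul_le_mul_of_nonneg_left (Real.rpow_le_rpow (by positivity) ?_ (abs_nonneg _))
      (Real.rpow_nonneg p1.le _)
    have h2 : ‖θ • p.2 j‖ ≤ ∑ i, ‖freqDiff i p‖ := by
      rw [norm_smul, Real.norm_eq_abs]
      exact (mul_le_of_le_one_left (norm_nonneg _) hθ).trans (norm_snd_le_sum_freqDiff p j)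
    refine le_trans ?_ (one_add_sum_le_prod Finset.univ (f := fun i => L * ‖freqDiff i p‖)
      fun i => by positivity)
    rw [← Finset.mul_sum]
    gcongr
  have hl : ((fun _ => x, fun _ => ξ) + amplitudeMap n d θ p).2 (Fin.last n) = ξ := by
    simp [amplitudeMap]
  rw [Fin.prod_univ_castSucc, Fin.sum_univ_castSucc, hl, Real.rpow_add p1]
  have hb0 : ∀ (ζ : E d) (s : ℝ), 0 ≤ bracket ψ ζ ^ s := fun ζ s =>
    Real.rpow_nonneg (zero_le_one.trans (h1 ζ)) _
  have h3 := Finset.prod_le_prod (s := Finset.univ) (fun _ _ => hb0 _ _) fun j _ => hj j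
  rw [Finset.prod_mul_distrib, ← Real.rpow_sum_of_pos p1,
    ← Real.rpow_sum_of_pos (zero_lt_one.trans_le hP1)] at h3
  rw [Real.finsetProd_rpow _ _ fun i _ => by positivity]
  calc _ ≤ _ := mul_le_mul_of_nonneg_right h3 (hb0 _ _)
    _ = _ := by ring

/-- The gain from ρ_g is simply discarded, which makes the final constant independent of g. -/
theorem bracket_rpow_sub_rho_le (h1 : ∀ ξ, 1 ≤ bracket ψ ξ) (ξ : E d) (s : ℝ) (g r : ℕ) :
    bracket ψ ξ ^ (s - (rho g r : ℝ)) ≤ bracket ψ ξ ^ s :=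
  Real.rpow_le_rpow_of_exponent_le (h1 ξ) (by simp)

theorem prod_bracket_rpow_sub_rho_le {k : ℕ} (h1 : ∀ ξ, 1 ≤ bracket ψ ξ) (ξ : Tup k d)
    (m : Fin k → ℝ) (g : ℕ) (r : Fin k → ℕ) :
    ∏ j, bracket ψ (ξ j) ^ (m j - (rho g (r j) : ℝ)) ≤ ∏ j, bracket ψ (ξ j) ^ m j :=
  Finset.prod_le_prod (fun _ _ => Real.rpow_nonneg (zero_le_one.trans (h1 _)) _)
    fun _ _ => bracket_rpow_sub_rho_le h1 _ _ _ _

theorem finite_setOf_order_le (k d l : ℕ) :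
    {α : Fin k → Fin d → ℕ | ∀ j, order (α j) ≤ l}.Finite :=
  (Set.finite_Iic fun _ _ => l).subset fun _ hα j i =>
    (Finset.single_le_sum (f := _) (fun _ _ => Nat.zero_le _) (Finset.mem_univ i)).trans (hα j)

theorem IsMultipleSymbol.norm_symbolDeriv_le {k g : ℕ} {m : Fin k → ℝ}
    {a : Tup k d × Tup k d → ℂ} (ha : IsMultipleSymbol ψ g m a) (h1 : ∀ ξ, 1 ≤ bracket ψ ξ)
    {l l' : ℕ} {α β : Fin k → Fin d → ℕ} (hα : ∀ j, order (α j) ≤ l) (hβ : ∀ j, order (β j) ≤ l')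
    (x ξ : Tup k d) :
    ‖symbolDeriv α β a (x, ξ)‖ ≤ symbolSeminorm ψ g m l l' a * ∏ j, bracket ψ (ξ j) ^ m j := by
  have hpos : ∀ ζ, 0 < bracket ψ ζ := fun ζ => zero_lt_one.trans_le (h1 ζ)
  have hcancel : ∀ (α : Fin k → Fin d → ℕ) (ξ : Tup k d),
      (∏ j, bracket ψ (ξ j) ^ (m j - (rho g (order (α j)) : ℝ))) *
        ∏ j, bracket ψ (ξ j) ^ (-m j + (rho g (order (α j)) : ℝ)) = 1 := by
    intro α ξ
    rw [← Finset.prod_mul_distrib]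
    refine Finset.prod_eq_one fun j _ => ?_
    rw [← Real.rpow_add (hpos _)]
    simp
  have hp : ∀ (s : Fin k → ℝ) (ξ : Tup k d), 0 < ∏ j, bracket ψ (ξ j) ^ s j := fun s ξ =>
    Finset.prod_pos fun j _ => Real.rpow_pos_of_pos (hpos _) _
  choose K hK using ha.bound
  obtain ⟨C, hC⟩ := (((finite_setOf_order_le k d l).prod (finite_setOf_order_le k d l')).image
    fun q : (Fin k → Fin d → ℕ) × (Fin k → Fin d → ℕ) => K q.1 q.2).bddAbove
  -- Needed because a real `sSup` bounds its set only if the set is bounded above; the bound is a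
  -- maximum over finitely many multi-indices.
  have hbdd : BddAbove {r : ℝ | ∃ (α β : Fin k → Fin d → ℕ) (x ξ : Tup k d),
      (∀ j, order (α j) ≤ l) ∧ (∀ j, order (β j) ≤ l') ∧
      r = ‖symbolDeriv α β a (x, ξ)‖
        * ∏ j, bracket ψ (ξ j) ^ (-m j + (rho g (order (α j)) : ℝ))} := by
    refine ⟨C, ?_⟩
    rintro r ⟨α, β, x, ξ, hα, hβ, rfl⟩
    refine le_trans ?_ (hC ⟨(α, β), ⟨hα, hβ⟩, rfl⟩)
    calc _ ≤ (K α β * ∏ j, bracket ψ (ξ j) ^ (m j - (rho g (order (α j)) : ℝ))) *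
          ∏ j, bracket ψ (ξ j) ^ (-m j + (rho g (order (α j)) : ℝ)) :=
          mul_le_mul_of_nonneg_right (hK α β x ξ) (hp _ _).le
      _ = K α β := by rw [mul_assoc, hcancel, mul_one]
  have h2 : ‖symbolDeriv α β a (x, ξ)‖ * ∏ j, bracket ψ (ξ j) ^ (-m j + (rho g (order (α j)) : ℝ))
      ≤ symbolSeminorm ψ g m l l' a := le_csSup hbdd ⟨α, β, x, ξ, hα, hβ, rfl⟩
  have h0 : 0 ≤ symbolSeminorm ψ g m l l' a :=
    (mul_nonneg (norm_nonneg _) (hp _ _).le).trans h2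
  calc ‖symbolDeriv α β a (x, ξ)‖ = ‖symbolDeriv α β a (x, ξ)‖ *
        (∏ j, bracket ψ (ξ j) ^ (-m j + (rho g (order (α j)) : ℝ))) *
          ∏ j, bracket ψ (ξ j) ^ (m j - (rho g (order (α j)) : ℝ)) := by
        rw [mul_assoc, mul_comm (∏ j, bracket ψ (ξ j) ^ (-m j + _)), hcancel, mul_one]
    _ ≤ symbolSeminorm ψ g m l l' a *
          ∏ j, bracket ψ (ξ j) ^ (m j - (rho g (order (α j)) : ℝ)) :=
        mul_le_mul_of_nonneg_right h2 (hp _ _).le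
    _ ≤ _ := mul_le_mul_of_nonneg_left (prod_bracket_rpow_sub_rho_le h1 ξ m g _) h0

theorem IsMultipleSymbol.tempGrowth_shiftedAmplitude {g : ℕ} {m : Fin (n + 1) → ℝ}
    {a : Tup (n + 1) d × Tup (n + 1) d → ℂ} (ha : IsMultipleSymbol ψ g m a)
    (hψ : IsAdmissible ψ) {θ : ℝ} (hθ : |θ| ≤ 1) (x ξ : E d) :
    TempGrowth (coordDirs n d) (shiftedAmplitude a θ x ξ) := by
  have h1 := hψ.one_le_bracket
  obtain ⟨L, hL, hlip⟩ := hψ.exists_lipschitz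
  have hs := contDiff_shiftedAmplitude ha.smooth θ x ξ
  refine ⟨hs, fun S hS => ?_⟩
  obtain ⟨T, U, hp⟩ := exists_perm_of_forall_mem_coordDirs hS
  rw [listDeriv_perm hp hs]
  obtain ⟨K, hK⟩ := ha.bound (fun j i => (freqIdx U).count (j, i))
    fun j i => (posIdx T).count (j, i)
  set M : ℝ := ∑ j : Fin n, |m j.castSucc| with hM
  have hM0 : 0 ≤ M := Finset.sum_nonneg fun _ _ => abs_nonneg _
  have hb0 : 0 ≤ bracket ψ ξ ^ (∑ j, m j) := Real.rpow_nonneg (zero_le_one.trans (h1 ξ)) _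
  refine ⟨⌈M⌉₊ * n, |K| * (bracket ψ ξ ^ (∑ j, m j) *
    ∏ i : Fin n, (1 + L * ‖(freqDiff i : (Tup n d × Tup n d) →L[ℝ] E d)‖) ^ M), fun z => ?_⟩
  have hi : ∀ i : Fin n, (1 + L * ‖freqDiff i z‖) ^ M ≤
      (1 + L * ‖(freqDiff i : (Tup n d × Tup n d) →L[ℝ] E d)‖) ^ M * (1 + ‖z‖) ^ ⌈M⌉₊ := by
    intro i
    have h2 : 1 + L * ‖freqDiff i z‖ ≤
        (1 + L * ‖(freqDiff i : (Tup n d × Tup n d) →L[ℝ] E d)‖) * (1 + ‖z‖) := by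
      have h3 := mul_le_mul_of_nonneg_left ((freqDiff i).le_opNorm z) hL
      have h4 : 0 ≤ L * ‖(freqDiff i : (Tup n d × Tup n d) →L[ℝ] E d)‖ := by positivity
      nlinarith [norm_nonneg z]
    refine (Real.rpow_le_rpow (by positivity) h2 hM0).trans ?_
    rw [Real.mul_rpow (by positivity) (by positivity), ← Real.rpow_natCast (1 + ‖z‖)]
    refine mul_le_mul_of_nonneg_left (Real.rpow_le_rpow_of_exponent_le ?_ (Nat.le_ceil M))
      (by positivity)
    linarith [norm_nonneg z]
  have hnn : ∀ ζ : Tup (n + 1) d, ∀ s : Fin (n + 1) → ℝ, 0 ≤ ∏ j, bracket ψ (ζ j) ^ s j :=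
    fun ζ s => Finset.prod_nonneg fun j _ => Real.rpow_nonneg (zero_le_one.trans (h1 _)) _
  calc _ ≤ _ := norm_listDeriv_shiftedAmplitude_le ha.smooth hθ x ξ T U z
    _ ≤ _ := hK _ _
    _ ≤ |K| * ∏ j, bracket ψ (((fun _ => x, fun _ => ξ) + amplitudeMap n d θ z).2 j) ^ m j :=
      mul_le_mul (le_abs_self K) (prod_bracket_rpow_sub_rho_le h1 _ m g _) (hnn _ _) (abs_nonneg _)
    _ ≤ |K| * (bracket ψ ξ ^ (∑ j, m j) * ∏ i, (1 + L * ‖freqDiff i z‖) ^ M) :=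
      mul_le_mul_of_nonneg_left (prod_bracket_rpow_le h1 hL hlip hθ m x ξ z) (abs_nonneg _)
    _ ≤ |K| * (bracket ψ ξ ^ (∑ j, m j) * ∏ i : Fin n,
          ((1 + L * ‖(freqDiff i : (Tup n d × Tup n d) →L[ℝ] E d)‖) ^ M * (1 + ‖z‖) ^ ⌈M⌉₊)) := by
      refine mul_le_mul_of_nonneg_left (mul_le_mul_of_nonneg_left ?_ hb0) (abs_nonneg _)
      exact Finset.prod_le_prod (fun i _ => by positivity) fun i _ => hi i
    _ = _ := by
      rw [Finset.prod_mul_distrib, Finset.prod_const, Finset.card_univ, Fintype.card_fin, ← pow_mul]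
      ring

end SymbolBounds

/-! ### Factorisation and finiteness of the weight integrals. -/

section Integrals

open MeasureTheory

/-- By triangularity the first variable occurs only in the first factor, with coefficient 1.
Integrating it out uses translation invariance and leaves a matrix of the same kind. -/
theorem lintegral_prod_unipotent {d : ℕ} {h : E d → ENNReal} (hh : Measurable h) {n : ℕ}
    (c : Fin n → Fin n → ℝ) (hd : ∀ j, c j j = 1) (hl : ∀ j r, r < j → c j r = 0) :
    ∫⁻ η : Tup n d, ∏ j, h (∑ r, c j r • η r) = (∫⁻ z, h z) ^ n := by
  induction n with
  | zero => simp [volume_pi]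
  | succ n ih =>
    have hm : ∀ {k : ℕ} (c : Fin k → ℝ), Measurable fun η : Tup k d => h (∑ r, c r • η r) :=
      fun c => hh.comp (by fun_prop)
    have hG : Measurable fun η : Tup n d => ∏ j : Fin n, h (∑ r, c j.succ r.succ • η r) :=
      Finset.measurable_fun_prod _ fun j _ => hm fun r => c j.succ r.succ
    have hF : Measurable fun η : Tup (n + 1) d => ∏ j, h (∑ r, c j r • η r) :=
      Finset.measurable_fun_prod _ fun j _ => hm (c j)
    have hmp := (volume_preserving_piFinSuccAbove (fun _ : Fin (n + 1) => E d) 0).symm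
    rw [← hmp.lintegral_comp hF]
    have e : ∀ q : E d × Tup n d, ∏ j, h (∑ r, c j r •
        ((MeasurableEquiv.piFinSuccAbove (fun _ : Fin (n + 1) => E d) 0).symm q) r) =
        h (q.1 + ∑ r : Fin n, c 0 r.succ • q.2 r) *
          ∏ j : Fin n, h (∑ r, c j.succ r.succ • q.2 r) := by
      intro q
      have e0 : ((MeasurableEquiv.piFinSuccAbove (fun _ : Fin (n + 1) => E d) 0).symm q) 0
          = q.1 := rfl
      have e1 : ∀ r : Fin n,
          ((MeasurableEquiv.piFinSuccAbove (fun _ : Fin (n + 1) => E d) 0).symm q) r.succ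
            = q.2 r := fun r => rfl
      simp only [Fin.prod_univ_succ, Fin.sum_univ_succ, e0, e1, hd, one_smul,
        hl _ _ (Fin.succ_pos _), zero_smul, zero_add]
    simp only [e]
    have hs : Measurable fun q : E d × Tup n d => h (q.1 + ∑ r : Fin n, c 0 r.succ • q.2 r) *
          ∏ j : Fin n, h (∑ r, c j.succ r.succ • q.2 r) :=
      (hh.comp (by fun_prop)).mul (hG.comp measurable_snd)
    have hvol : (volume : Measure (E d × Tup n d)) = volume.prod volume := rfl
    rw [hvol, lintegral_prod_symm' _ hs]
    have e2 : ∀ η : Tup n d, ∫⁻ z : E d, h (z + ∑ r : Fin n, c 0 r.succ • η r) *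
        ∏ j : Fin n, h (∑ r, c j.succ r.succ • η r) =
        (∫⁻ z, h z) * ∏ j : Fin n, h (∑ r, c j.succ r.succ • η r) := by
      intro η
      have hz : Measurable fun z : E d => h (z + ∑ r : Fin n, c 0 r.succ • η r) :=
        hh.comp (by fun_prop)
      rw [lintegral_mul_const _ hz,
        lintegral_add_right_eq_self (fun z => h z)]
    simp only [e2]
    rw [lintegral_const_mul _ hG, ih (fun j r => c j.succ r.succ) (fun j => hd _)
      (fun j r hr => hl _ _ (Fin.succ_lt_succ_iff.2 hr)), pow_succ, mul_comm]

theorem integrable_prod_weights {n d : ℕ} {h₁ h₂ : E d → ℝ} (c₁ : Continuous h₁)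
    (c₂ : Continuous h₂) (n₁ : ∀ z, 0 ≤ h₁ z) (n₂ : ∀ z, 0 ≤ h₂ z) (i₁ : Integrable h₁)
    (i₂ : Integrable h₂) :
    Integrable (fun p : Tup n d × Tup n d => (∏ j, h₁ (posMap j p)) * ∏ j, h₂ (freqDiff j p)) ∧
      ∫ p : Tup n d × Tup n d, (∏ j, h₁ (posMap j p)) * ∏ j, h₂ (freqDiff j p) =
        ((∫ z, h₁ z) * ∫ z, h₂ z) ^ n := by
  have m₁ : Measurable fun z => ENNReal.ofReal (h₁ z) := c₁.measurable.ennreal_ofReal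
  have m₂ : Measurable fun z => ENNReal.ofReal (h₂ z) := c₂.measurable.ennreal_ofReal
  have hc : Continuous fun p : Tup n d × Tup n d =>
      (∏ j, h₁ (posMap j p)) * ∏ j, h₂ (freqDiff j p) := by fun_prop
  have hnn : ∀ p : Tup n d × Tup n d, 0 ≤ (∏ j, h₁ (posMap j p)) * ∏ j, h₂ (freqDiff j p) :=
    fun p => mul_nonneg (Finset.prod_nonneg fun j _ => n₁ _) (Finset.prod_nonneg fun j _ => n₂ _)
  have I₁ := ofReal_integral_eq_lintegral_ofReal i₁ (.of_forall n₁)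
  have I₂ := ofReal_integral_eq_lintegral_ofReal i₂ (.of_forall n₂)
  have k₁ := lintegral_prod_unipotent m₁ (n := n) (fun j r => if r = j then 1 else 0)
    (by simp) (fun j r hr => if_neg hr.ne)
  have k₂ := lintegral_prod_unipotent m₂ (n := n) bidiag (by simp [bidiag])
    (fun j r hr => bidiag_eq_zero (Fin.val_ne_of_ne hr.ne)
      (by have := Fin.lt_def.1 hr; omega))
  have hlin : ∫⁻ p : Tup n d × Tup n d,
      ENNReal.ofReal ((∏ j, h₁ (posMap j p)) * ∏ j, h₂ (freqDiff j p)) =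
        ENNReal.ofReal (((∫ z, h₁ z) * ∫ z, h₂ z) ^ n) := by
    have e : ∀ p : Tup n d × Tup n d,
        ENNReal.ofReal ((∏ j, h₁ (posMap j p)) * ∏ j, h₂ (freqDiff j p)) =
        (∏ j, ENNReal.ofReal (h₁ (∑ r, (if r = j then (1 : ℝ) else 0) • p.1 r))) *
          ∏ j, ENNReal.ofReal (h₂ (∑ r, bidiag j r • p.2 r)) := by
      intro p
      rw [ENNReal.ofReal_mul (Finset.prod_nonneg fun j _ => n₁ _),
        ENNReal.ofReal_prod_of_nonneg fun j _ => n₁ _,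
        ENNReal.ofReal_prod_of_nonneg fun j _ => n₂ _]
      simp [posMap_apply, freqDiff_apply]
    have hvol : (volume : Measure (Tup n d × Tup n d)) = volume.prod volume := rfl
    simp only [e]
    rw [hvol, lintegral_prod_mul
      (f := fun y : Tup n d => ∏ j, ENNReal.ofReal (h₁ (∑ r, (if r = j then (1 : ℝ) else 0) • y r)))
      (g := fun η : Tup n d => ∏ j, ENNReal.ofReal (h₂ (∑ r, bidiag j r • η r)))
      (Finset.measurable_fun_prod _ fun j _ => m₁.comp (by fun_prop)).aemeasurable
      (Finset.measurable_fun_prod _ fun j _ => m₂.comp (by fun_prop)).aemeasurable, k₁, k₂,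
      ENNReal.ofReal_pow (mul_nonneg (integral_nonneg n₁) (integral_nonneg n₂)),
      ENNReal.ofReal_mul (integral_nonneg n₁), I₁, I₂, mul_pow]
  refine ⟨⟨hc.aestronglyMeasurable, ?_⟩, ?_⟩
  · rw [hasFiniteIntegral_iff_ofReal (.of_forall hnn), hlin]
    exact ENNReal.ofReal_lt_top
  · rw [integral_eq_lintegral_of_nonneg_ae (.of_forall hnn) hc.aestronglyMeasurable, hlin,
      ENNReal.toReal_ofReal (pow_nonneg (mul_nonneg (integral_nonneg n₁) (integral_nonneg n₂)) n)]

/-- The weight `(1 + |z|²)^{-N} (1 + L |z|)^M`. -/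
def decayWeight {d : ℕ} (N : ℕ) (L M : ℝ) (z : E d) : ℝ :=
  ((1 + ‖z‖ ^ 2)⁻¹) ^ N * (1 + L * ‖z‖) ^ M

theorem decayWeight_nonneg {d : ℕ} (N : ℕ) {L : ℝ} (hL : 0 ≤ L) (M : ℝ) (z : E d) :
    0 ≤ decayWeight N L M z := by
  unfold decayWeight
  positivity

theorem continuous_decayWeight {d : ℕ} (N : ℕ) {L : ℝ} (hL : 0 ≤ L) (M : ℝ) :
    Continuous (decayWeight N L M : E d → ℝ) := by
  unfold decayWeight
  refine Continuous.mul ?_ ?_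
  · exact (Continuous.inv₀ (by fun_prop) fun z => by positivity).pow N
  · exact Continuous.rpow_const (by fun_prop) fun z => .inl (by positivity)

/-- Comparison with (1 + |z|)^{-(2N - M)}, integrable on ℝ^d exactly in the range assumed. -/
theorem integrable_decayWeight {d N : ℕ} {L M : ℝ} (hL : 0 ≤ L) (hM : 0 ≤ M)
    (hN : (d : ℝ) + M < 2 * N) : Integrable (decayWeight N L M : E d → ℝ) := by
  have h1 : Integrable (fun z : E d => (2 ^ N * (1 + L) ^ M) * (1 + ‖z‖) ^ (-(2 * N - M))) :=
    (integrable_one_add_norm (by rw [finrank_euclideanSpace, Fintype.card_fin]; linarith)).const_mul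
      _
  refine h1.mono' (continuous_decayWeight N hL M).aestronglyMeasurable (.of_forall fun z => ?_)
  rw [Real.norm_of_nonneg (decayWeight_nonneg N hL M z), decayWeight]
  have hz := norm_nonneg z
  have e1 : (1 + ‖z‖) ^ (-(2 * (N : ℝ) - M)) = ((1 + ‖z‖) ^ 2)⁻¹ ^ N * (1 + ‖z‖) ^ M := by
    have h2N : 2 * (N : ℝ) = ((2 * N : ℕ) : ℝ) := by push_cast; ring
    rw [neg_sub, sub_eq_add_neg, Real.rpow_add (by positivity), mul_comm,
      Real.rpow_neg (by positivity),
      h2N, Real.rpow_natCast, pow_mul, inv_pow]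
  have h2 : (1 + ‖z‖ ^ 2)⁻¹ ≤ 2 * ((1 + ‖z‖) ^ 2)⁻¹ := by
    rw [← div_eq_mul_inv, inv_eq_one_div, div_le_div_iff₀ (by positivity) (by positivity)]
    nlinarith [sq_nonneg (‖z‖ - 1)]
  have h3 : 1 + L * ‖z‖ ≤ (1 + L) * (1 + ‖z‖) := by nlinarith
  rw [e1]
  calc _ ≤ (2 * ((1 + ‖z‖) ^ 2)⁻¹) ^ N * ((1 + L) * (1 + ‖z‖)) ^ M :=
        mul_le_mul (pow_le_pow_left₀ (by positivity) h2 N)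
          (Real.rpow_le_rpow (by positivity) h3 hM) (by positivity) (by positivity)
    _ = _ := by
        rw [mul_pow, Real.mul_rpow (by positivity) (by positivity)]
        ring

end Integrals

/-! ### The cut-off and its derivatives. -/

section Regularisation

variable {V : Type*} [NormedAddCommGroup V] [NormedSpace ℝ V]

/-- Bounds for a Schwartz cut-off `χ (ε z)`, uniform in `ε`. -/
theorem exists_bound_cutoff (χ : 𝓢(V, ℂ)) {B : Set V} (hB : B.Finite) (m : ℕ) :
    ∃ X : ℝ, 0 ≤ X ∧ (∀ z, ‖χ z‖ ≤ X) ∧ ∀ ε : ℝ, 0 < ε → ε ≤ 1 → ∀ S : List V, S.length ≤ m →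
      (∀ v ∈ S, v ∈ B) → ∀ z,
        ‖listDeriv S (fun z => χ (ε • z) - 1) z‖ ≤ ‖χ (ε • z) - 1‖ + ε * X := by
  have hb : ∀ S : List V, ∃ C, ∀ z, ‖listDeriv S χ z‖ ≤ C := by
    intro S
    obtain ⟨φ, hφ⟩ := listDeriv_schwartz χ S
    obtain ⟨C, hC⟩ := norm_schwartz_le φ 0
    exact ⟨C, fun z => by simpa [hφ] using hC z⟩
  choose C hC using hb
  obtain ⟨X, hX⟩ := ((finite_setOf_list m hB).image C).bddAbove
  have hX' : ∀ S : List V, S.length ≤ m → (∀ v ∈ S, v ∈ B) → ∀ z, ‖listDeriv S χ z‖ ≤ X :=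
    fun S h1 h2 z => (hC S z).trans (hX ⟨S, ⟨h1, h2⟩, rfl⟩)
  have hX0 : 0 ≤ X := (norm_nonneg _).trans (hX' [] (by simp) (by simp) 0)
  refine ⟨X, hX0, hX' [] (by simp) (by simp), fun ε hε hε1 S h1 h2 z => ?_⟩
  -- Without derivatives the first term suffices; with at least one, the constant 1 drops out and a
  -- factor ε appears.
  cases S with
  | nil => simpa using mul_nonneg hε.le hX0
  | cons v S =>
    have h0 : listDeriv (v :: S) (fun _ : V => (1 : ℂ)) = fun _ => 0 := by
      rw [listDeriv_cons, dirDeriv_const, listDeriv_zero]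
    rw [listDeriv_sub _ (contDiff_schwartz_comp_smul χ ε) contDiff_const, h0,
      listDeriv_comp_smul (χ.smooth ⊤)]
    simp only [sub_zero]
    rw [norm_mul, Complex.norm_real, Real.norm_of_nonneg (by positivity)]
    have h3 : ε ^ (v :: S).length ≤ ε := by
      rw [List.length_cons, pow_succ]
      exact mul_le_of_le_one_left hε.le (pow_le_one₀ hε.le hε1)
    calc _ ≤ ε * X := mul_le_mul h3 (hX' _ h1 h2 _) (norm_nonneg _) hε.le
      _ ≤ _ := le_add_of_nonneg_left (norm_nonneg _)

end Regularisation

/-! ### Existence and size of the oscillatory integral. -/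

section Main

open MeasureTheory Filter Topology

variable {n d : ℕ} {ψ : E d → ℝ}

/-- The oscillatory integral, computed after the integrations by parts. -/
def oscIntegral (N N' : ℕ) (f : Tup n d × Tup n d → ℂ) : ℂ :=
  (((2 * Real.pi) ^ (n * d) : ℝ) : ℂ)⁻¹ * ∫ p, oscFactor p * oscTransform N N' f p

/-- If the transformed integrand is dominated, the oscillatory integral exists. -/
theorem isOscIntegral_oscIntegral (N N' : ℕ) {f : Tup n d × Tup n d → ℂ}
    (hf : TempGrowth (coordDirs n d) f) {A : Tup n d × Tup n d → ℝ}
    (hA : ∀ p, ∀ T S : List (Fin n × Fin d), (∀ j, T.countP (fun p => p.1 = j) ≤ 2 * N) →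
      (∀ j, S.countP (fun p => p.1 = j) ≤ 2 * N') →
      ‖listDeriv (T.map (fun p => posDir p.1 p.2) ++ S.map fun p => freqDir p.1 p.2) f p‖ ≤ A p)
    (hint : Integrable fun p => ‖weightProd posMap (repList n N') p‖ *
        ‖weightProd freqDiff (repList n N) p‖ * A p) :
    IsOscIntegral f (oscIntegral N N' f) := by
  intro χ hχ
  have hu : ∀ ε : ℝ, 0 < ε → RapidDecay (coordDirs n d) fun p => χ (ε • p) * f p := by
    intro ε hε
    simp only [mul_comm (χ _)]
    exact hf.mul_rapidDecay (rapidDecay_schwartz_comp_smul χ hε)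
  constructor
  · intro ε hε
    simp only [mul_assoc]
    exact (hu ε hε).integrable_mul contDiff_oscFactor.continuous fun z => (norm_oscFactor z).le
  obtain ⟨C, hC1, hC⟩ := norm_oscTransform_le d N N'
  obtain ⟨X, hX0, hX, hXε⟩ := exists_bound_cutoff χ (finite_coordDirs n d)
    (n * (2 * N) + n * (2 * N'))
  set W : Tup n d × Tup n d → ℝ := fun p => ‖weightProd posMap (repList n N') p‖ *
    ‖weightProd freqDiff (repList n N) p‖ * A p with hW
  have hχs : ∀ ε : ℝ, ContDiff ℝ ∞ fun p : Tup n d × Tup n d => χ (ε • p) :=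
    contDiff_schwartz_comp_smul χ
  have hmem : ∀ T S : List (Fin n × Fin d),
      ∀ v ∈ T.map (fun p => posDir p.1 p.2) ++ S.map fun p => freqDir p.1 p.2,
        v ∈ coordDirs n d := by
    intro T S v hv
    rcases List.mem_append.1 hv with hv | hv <;> obtain ⟨q, -, rfl⟩ := List.mem_map.1 hv
    · exact posDir_mem _ _
    · exact freqDir_mem _ _
  set D : ℝ := C ^ n * 2 ^ (n * (2 * N) + n * (2 * N')) with hD
  have hD0 : 0 ≤ D := by positivity
  have hA0 : ∀ p, 0 ≤ A p := fun p => (norm_nonneg _).trans (hA p [] [] (by simp) (by simp))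
  have hW0 : ∀ p, 0 ≤ W p := fun p => by
    have := hA0 p
    positivity
  have hdiff : ∀ ε : ℝ, 0 < ε → ε ≤ 1 → ∀ p,
      ‖oscTransform N N' (fun p => χ (ε • p) * f p) p - oscTransform N N' f p‖
        ≤ D * (‖χ (ε • p) - 1‖ + ε * X) * W p := by
    intro ε hε hε1 p
    rw [← oscTransform_sub N N' ((hχs ε).mul hf.smooth) hf.smooth]
    -- By linearity the error is the transform of (χ(ε·) - 1) f, in which every Leibniz term carries
    -- a factor tending to 0 with ε.
    have e : (fun p => χ (ε • p) * f p - f p) = fun p => (χ (ε • p) - 1) * f p := by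
      funext p; ring
    rw [e]
    have hδ : 0 ≤ ‖χ (ε • p) - 1‖ + ε * X := by positivity
    have hs1 : ContDiff ℝ ∞ fun p : Tup n d × Tup n d => χ (ε • p) - 1 :=
      (hχs ε).sub contDiff_const
    refine (hC n _ p (2 ^ (n * (2 * N) + n * (2 * N')) * ((‖χ (ε • p) - 1‖ + ε * X) * A p))
      (hs1.mul hf.smooth) ?_).trans (le_of_eq ?_)
    · intro T S hT hS
      have hlen : (T.map (fun p => posDir p.1 p.2) ++ S.map fun p => freqDir p.1 p.2).length
          ≤ n * (2 * N) + n * (2 * N') := by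
        rw [List.length_append, List.length_map, List.length_map]
        exact add_le_add (length_le_of_countP_le hT) (length_le_of_countP_le hS)
      refine (norm_listDeriv_mul_le _ hs1 hf.smooth p
        (A := ‖χ (ε • p) - 1‖ + ε * X) (B := A p) ?_ ?_).trans ?_
      · intro L hL
        exact hXε ε hε hε1 L (hL.length_le.trans hlen) (fun v hv => hmem T S v (hL.subset hv)) p
      · intro L hL
        obtain ⟨L₁, L₂, rfl, h1, h2⟩ := List.sublist_append_iff.1 hL
        obtain ⟨T', hT', rfl⟩ := List.sublist_map_iff.1 h1
        obtain ⟨S', hS', rfl⟩ := List.sublist_map_iff.1 h2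
        exact hA p T' S' (fun j => hT'.countP_le.trans (hT j)) fun j => hS'.countP_le.trans (hS j)
      · exact mul_le_mul_of_nonneg_right (pow_le_pow_right₀ (by norm_num) hlen)
          (mul_nonneg hδ (hA0 p))
    · rw [hD, hW]
      ring
  have hT : ∀ p, ‖oscTransform N N' f p‖ ≤ C ^ n * W p := fun p => hC n f p (A p) hf.smooth (hA p)
  have hlim : ∀ p, Tendsto (fun ε : ℝ => D * (‖χ (ε • p) - 1‖ + ε * X) * W p) (𝓝[>] 0) (𝓝 0) := by
    intro p
    have hc : Continuous fun ε : ℝ => D * (‖χ (ε • p) - 1‖ + ε * X) * W p := by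
      have := χ.continuous
      fun_prop
    have := hc.tendsto 0
    simp only [zero_smul, hχ, sub_self, norm_zero, zero_mul, add_zero, mul_zero] at this
    exact this.mono_left nhdsWithin_le_nhds
  have hev : ∀ᶠ ε : ℝ in 𝓝[>] 0, 0 < ε ∧ ε ≤ 1 := by
    filter_upwards [Ioc_mem_nhdsGT (zero_lt_one' ℝ)] with ε hε using hε
  refine Tendsto.const_mul _ ?_
  have key : Tendsto (fun ε : ℝ => ∫ p : Tup n d × Tup n d, oscFactor p *
      oscTransform N N' (fun p => χ (ε • p) * f p) p) (𝓝[>] 0)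
      (𝓝 (∫ p, oscFactor p * oscTransform N N' f p)) := by
    refine tendsto_integral_filter_of_dominated_convergence
      (fun p => (C ^ n + D * ((X + 1) + X)) * W p) ?_ ?_ (hint.const_mul _) ?_
    · refine .of_forall fun ε => ?_
      exact (contDiff_oscFactor.continuous.mul
        (contDiff_oscTransform N N' ((hχs ε).mul hf.smooth)).continuous).aestronglyMeasurable
    · filter_upwards [hev] with ε hε
      refine .of_forall fun p => ?_
      rw [norm_mul, norm_oscFactor, one_mul]
      have h1 := hdiff ε hε.1 hε.2 p
      have h2 : ‖χ (ε • p) - 1‖ + ε * X ≤ (X + 1) + X := by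
        refine add_le_add ((norm_sub_le _ _).trans ?_) (mul_le_of_le_one_left hX0 hε.2)
        simpa using hX (ε • p)
      have h3 : D * (‖χ (ε • p) - 1‖ + ε * X) * W p ≤ D * ((X + 1) + X) * W p :=
        mul_le_mul_of_nonneg_right (mul_le_mul_of_nonneg_left h2 hD0) (hW0 p)
      have h4 := norm_le_norm_add_norm_sub (oscTransform N N' f p)
        (oscTransform N N' (fun p => χ (ε • p) * f p) p)
      rw [norm_sub_rev] at h4
      have h5 := hT p
      linarith
    · refine .of_forall fun p => Tendsto.const_mul _ ?_
      rw [tendsto_iff_norm_sub_tendsto_zero]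
      refine squeeze_zero' (.of_forall fun _ => norm_nonneg _) ?_ (hlim p)
      filter_upwards [hev] with ε hε using hdiff ε hε.1 hε.2 p
  -- The integrations by parts are undone for fixed ε > 0, where the integrand decays rapidly.
  refine key.congr' ?_
  filter_upwards [hev] with ε hε
  rw [← integral_oscFactor_mul N N' (hu ε hε.1)]
  simp only [mul_assoc]
  rfl

theorem norm_oscIntegral_le (d N N' : ℕ) :
    ∃ C : ℝ, 1 ≤ C ∧ ∀ (n : ℕ) (f : Tup n d × Tup n d → ℂ) (A : Tup n d × Tup n d → ℝ),
      ContDiff ℝ ∞ f →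
      (∀ p, ∀ T S : List (Fin n × Fin d), (∀ j, T.countP (fun p => p.1 = j) ≤ 2 * N) →
        (∀ j, S.countP (fun p => p.1 = j) ≤ 2 * N') →
        ‖listDeriv (T.map (fun p => posDir p.1 p.2) ++ S.map fun p => freqDir p.1 p.2) f p‖
          ≤ A p) →
      (Integrable fun p => ‖weightProd posMap (repList n N') p‖ *
        ‖weightProd freqDiff (repList n N) p‖ * A p) →
      ‖oscIntegral N N' f‖ ≤ C ^ n * ∫ p, ‖weightProd posMap (repList n N') p‖ *
        ‖weightProd freqDiff (repList n N) p‖ * A p := by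
  obtain ⟨C, hC1, hC⟩ := norm_oscTransform_le d N N'
  refine ⟨C, hC1, fun n f A hf hA hint => ?_⟩
  have h1 : ‖∫ p : Tup n d × Tup n d, oscFactor p * oscTransform N N' f p‖ ≤
      C ^ n * ∫ p, ‖weightProd posMap (repList n N') p‖ *
        ‖weightProd freqDiff (repList n N) p‖ * A p := by
    rw [← integral_const_mul]
    refine norm_integral_le_of_norm_le (hint.const_mul _) (.of_forall fun p => ?_)
    rw [norm_mul, norm_oscFactor, one_mul]
    exact hC n f p (A p) hf (hA p)
  have h2 : ‖(((2 * Real.pi) ^ (n * d) : ℝ) : ℂ)⁻¹‖ ≤ 1 := by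
    rw [norm_inv, Complex.norm_real, Real.norm_of_nonneg (by positivity)]
    refine inv_le_one_of_one_le₀ (one_le_pow₀ ?_)
    linarith [Real.pi_gt_three]
  rw [oscIntegral, norm_mul]
  exact (mul_le_of_le_one_left (norm_nonneg _) h2).trans h1

theorem norm_weightProd {n d : ℕ} (T : Fin n → (Tup n d × Tup n d) →L[ℝ] E d) (N : ℕ)
    (p : Tup n d × Tup n d) :
    ‖weightProd T (repList n N) p‖ = ∏ j, ((1 + ‖T j p‖ ^ 2)⁻¹) ^ N := by
  simp only [weightProd_repList, norm_prod, norm_pow, norm_invBracket]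

/-- The oscillatory integral of a multiple symbol and its bound, for a fixed value `M` of
`∑ |m_j|`. -/
theorem exists_const_oscIntegral_le (hψ : IsAdmissible ψ) {M : ℝ} (hM : 0 ≤ M) {N N' : ℕ}
    (hN : (d : ℝ) + M < 2 * N) (hN' : (d : ℝ) < 2 * N') :
    ∃ C : ℝ, 1 ≤ C ∧ ∀ (n g : ℕ) (m : Fin (n + 1) → ℝ) (a : Tup (n + 1) d × Tup (n + 1) d → ℂ),
      IsMultipleSymbol ψ g m a → ∑ j : Fin n, |m j.castSucc| = M → ∀ θ : ℝ, |θ| ≤ 1 →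
      ∀ x ξ : E d, IsOscIntegral (shiftedAmplitude a θ x ξ)
          (oscIntegral N N' (shiftedAmplitude a θ x ξ)) ∧
        ‖oscIntegral N N' (shiftedAmplitude a θ x ξ)‖ ≤
          C ^ (n + 2) * symbolSeminorm ψ g m (2 * N') (2 * N) a * bracket ψ ξ ^ (∑ j, m j) := by
  obtain ⟨L, hL, hlip⟩ := hψ.exists_lipschitz
  obtain ⟨C, hC1, hC⟩ := norm_oscIntegral_le d N N'
  have hb1 := hψ.one_le_bracket
  -- The contribution of one pair (y^j, η^j - η^{j+1}) to the factorised integral.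
  set κ : ℝ := (∫ z : E d, decayWeight N' 0 0 z) * ∫ z : E d, decayWeight N L M z with hκ
  have hκ0 : 0 ≤ κ := mul_nonneg (integral_nonneg (decayWeight_nonneg N' le_rfl 0))
    (integral_nonneg (decayWeight_nonneg N hL M))
  -- The estimate produces (C κ)^n; a base of at least 1 allows raising the exponent to n + 2 = k +
  -- 1.
  refine ⟨max 1 (C * κ), le_max_left _ _, fun n g m a ha hm θ hθ x ξ => ?_⟩
  set f := shiftedAmplitude a θ x ξ with hf
  set s : ℝ := symbolSeminorm ψ g m (2 * N') (2 * N) a with hs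
  set t : ℝ := bracket ψ ξ ^ (∑ j, m j) with ht
  have ht0 : 0 ≤ t := Real.rpow_nonneg (zero_le_one.trans (hb1 ξ)) _
  have hsym : ∀ {α β : Fin (n + 1) → Fin d → ℕ}, (∀ j, order (α j) ≤ 2 * N') →
      (∀ j, order (β j) ≤ 2 * N) → ∀ z ζ : Tup (n + 1) d,
      ‖symbolDeriv α β a (z, ζ)‖ ≤ s * ∏ j, bracket ψ (ζ j) ^ m j := fun hα hβ z ζ =>
    ha.norm_symbolDeriv_le hb1 hα hβ z ζ
  have hs0 : 0 ≤ s := by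
    have h := (norm_nonneg _).trans (hsym (α := 0) (β := 0) (by simp [order]) (by simp [order])
      0 fun _ => ξ)
    exact nonneg_of_mul_nonneg_left h (Finset.prod_pos fun j _ =>
      Real.rpow_pos_of_pos (zero_lt_one.trans_le (hb1 ξ)) _)
  let A : Tup n d × Tup n d → ℝ := fun p => s * (t * ∏ i, (1 + L * ‖freqDiff i p‖) ^ M)
  have hA : ∀ p, ∀ T S : List (Fin n × Fin d), (∀ j, T.countP (fun p => p.1 = j) ≤ 2 * N) →
      (∀ j, S.countP (fun p => p.1 = j) ≤ 2 * N') →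
      ‖listDeriv (T.map (fun p => posDir p.1 p.2) ++ S.map fun p => freqDir p.1 p.2) f p‖
        ≤ A p := by
    intro p T S hT hS
    refine (norm_listDeriv_shiftedAmplitude_le ha.smooth hθ x ξ T S p).trans
      ((hsym (fun j => ?_) (fun j => ?_) _ _).trans (mul_le_mul_of_nonneg_left ?_ hs0))
    · rw [order_count]; exact countP_freqIdx_le hS j
    · rw [order_count]; exact countP_posIdx_le hT j
    · rw [ht, ← hm]; exact prod_bracket_rpow_le hb1 hL hlip hθ m x ξ p
  have hw : ∀ p : Tup n d × Tup n d, ‖weightProd posMap (repList n N') p‖ *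
      ‖weightProd freqDiff (repList n N) p‖ * A p =
        s * t * ((∏ j, decayWeight N' 0 0 (posMap j p)) *
          ∏ j, decayWeight N L M (freqDiff j p)) := by
    intro p
    simp only [norm_weightProd, decayWeight, Finset.prod_mul_distrib, Real.rpow_zero,
      Finset.prod_const_one, A]
    ring
  obtain ⟨hi, he⟩ := integrable_prod_weights (n := n) (continuous_decayWeight (d := d) N' le_rfl 0)
    (continuous_decayWeight N hL M) (decayWeight_nonneg N' le_rfl 0) (decayWeight_nonneg N hL M)
    (integrable_decayWeight le_rfl le_rfl (by simpa using hN')) (integrable_decayWeight hL hM hN)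
  have hint : Integrable fun p : Tup n d × Tup n d => ‖weightProd posMap (repList n N') p‖ *
      ‖weightProd freqDiff (repList n N) p‖ * A p := by
    simp only [hw]
    exact hi.const_mul _
  refine ⟨isOscIntegral_oscIntegral N N' (ha.tempGrowth_shiftedAmplitude hψ hθ x ξ) hA hint, ?_⟩
  refine (hC n f A (contDiff_shiftedAmplitude ha.smooth θ x ξ) hA hint).trans ?_
  simp only [hw]
  rw [integral_const_mul, he]
  have h1 : (C * κ) ^ n ≤ max 1 (C * κ) ^ (n + 2) :=
    (pow_le_pow_left₀ (by positivity) (le_max_right _ _) n).trans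
      (pow_le_pow_right₀ (le_max_left _ _) (by omega))
  calc _ = (C * κ) ^ n * (s * t) := by rw [mul_pow]; ring
    _ ≤ max 1 (C * κ) ^ (n + 2) * (s * t) := mul_le_mul_of_nonneg_right h1 (mul_nonneg hs0 ht0)
    _ = _ := by ring

end Main

end NegDefSymbol

end

/-- The number of blocks of the multiple symbol is `k = n + 1`. -/
theorem mainTheorem4 (d : ℕ) (ψ : E d → ℝ) (hψ : IsAdmissible ψ) :
    ∃ C : ℝ → ℝ, (∀ M, 0 < C M) ∧
      ∀ (n g : ℕ) (_ : g ≤ 2) (m : Fin (n + 1) → ℝ) (a : Tup (n + 1) d × Tup (n + 1) d → ℂ)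
        (_ : IsMultipleSymbol ψ g m a) (θ : ℝ) (_ : |θ| ≤ 1),
        ∃ b : E d → E d → ℂ,
          (∀ x ξ : E d, IsOscIntegral (shiftedAmplitude a θ x ξ) (b x ξ)) ∧
          ∀ x ξ : E d,
            ‖b x ξ‖ ≤ C (∑ j : Fin n, |m j.castSucc|) ^ ((n + 1) + 1)
              * symbolSeminorm ψ g m
                  (2 * ⌈(d : ℝ) / 2 + 1⌉₊)
                  (2 * ⌈((d : ℝ) + ∑ j : Fin n, |m j.castSucc|) / 2 + 1⌉₊) a
              * bracket ψ ξ ^ (∑ j, m j) := by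
  -- Applied to r = d + M and r = d, this is the strict inequality needed for integrability, with N
  -- and N' half the derivative numbers l' and l.
  have hceil : ∀ r : ℝ, r < 2 * (⌈r / 2 + 1⌉₊ : ℝ) := fun r => by
    have := Nat.le_ceil (r / 2 + 1)
    linarith
  have key : ∀ M : ℝ, ∃ C : ℝ, 1 ≤ C ∧ (0 ≤ M → ∀ (n g : ℕ) (m : Fin (n + 1) → ℝ)
      (a : Tup (n + 1) d × Tup (n + 1) d → ℂ), IsMultipleSymbol ψ g m a →
      ∑ j : Fin n, |m j.castSucc| = M → ∀ θ : ℝ, |θ| ≤ 1 → ∀ x ξ : E d,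
      IsOscIntegral (shiftedAmplitude a θ x ξ)
        (oscIntegral ⌈((d : ℝ) + M) / 2 + 1⌉₊ ⌈(d : ℝ) / 2 + 1⌉₊ (shiftedAmplitude a θ x ξ)) ∧
      ‖oscIntegral ⌈((d : ℝ) + M) / 2 + 1⌉₊ ⌈(d : ℝ) / 2 + 1⌉₊ (shiftedAmplitude a θ x ξ)‖ ≤
        C ^ (n + 2) * symbolSeminorm ψ g m (2 * ⌈(d : ℝ) / 2 + 1⌉₊)
          (2 * ⌈((d : ℝ) + M) / 2 + 1⌉₊) a * bracket ψ ξ ^ (∑ j, m j)) := by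
    intro M
    by_cases hM : 0 ≤ M
    · obtain ⟨C, h1, h2⟩ := exists_const_oscIntegral_le hψ hM (hceil ((d : ℝ) + M)) (hceil d)
      exact ⟨C, h1, fun _ => h2⟩
    -- For negative M nothing is claimed, and any value at least 1 makes the constant a total
    -- function of M.
    · exact ⟨1, le_rfl, fun h => absurd h hM⟩
  choose C hC1 hC using key
  refine ⟨C, fun M => zero_lt_one.trans_le (hC1 M), fun n g _ m a ha θ hθ => ?_⟩
  have h := hC _ (Finset.sum_nonneg fun j _ => abs_nonneg _) n g m a ha rfl θ hθ
  exact ⟨_, fun x ξ => (h x ξ).1, fun x ξ => (h x ξ).2⟩
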